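/- Let $N\ge 1$, let $\Omega\subset\mathbb R^N$ be a bounded domain (a nonempty bounded connected open set) of class $C^{4,\alpha}$ for some $\alpha\in\,]0,1[$, and let $\sigma\in[0,1[$. All functions are real-valued and $H^2(\Omega)$ carries its standard norm. For $u,\varphi\in H^2(\Omega)$ put $$\mathcal A_\sigma(u,\varphi)=\int_\Omega (1-\sigma)\,D^2u:D^2\varphi+\sigma\,\Delta u\,\Delta\varphi\,dx .$$ A number $\lambda\in\mathbb R$ is called a Neumann eigenvalue if there is $u\in H^2(\Omega)$, $u\neq0$ (an eigenfunction), with $\mathcal A_\sigma(u,\varphi)=\lambda\int_\Omega u\varphi\,dx$ for all $\varphi\in H^2(\Omega)$; its multiplicity is the dimension of the space of all solutions $u$. Let $\mathcal N\subset H^2(\Omega)$ be the subspace generated by $1,x_1,\dots,x_N$, let $p:H^2(\Omega)\to H^2(\Omega)/\mathcal N$ be the canonical projection, and let $$H^2_{\mathcal N}(\Omega)=\Big\{u\in H^2(\Omega):\int_\Omega u\,dx=\int_\Omega \tfrac{\partial u}{\partial x_i}\,dx=0,\ i=1,\dots,N\Big\},\qquad F(\Omega)=\{G\in H^2(\Omega)':G[1]=G[x_i]=0,\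 i=1,\dots,N\}.$$ Define $\pi_{\mathcal N}:H^2(\Omega)\to H^2_{\mathcal N}(\Omega)$ by $$\pi_{\mathcal N}[u]=u-\frac1{|\Omega|}\int_\Omega u\,dx+\frac1{|\Omega|^2}\sum_{i=1}^N\Big(\int_\Omega\tfrac{\partial u}{\partial x_i}dx\Big)\Big(\int_\Omega x_i\,dx\Big)-\frac1{|\Omega|}\sum_{i=1}^N\Big(\int_\Omega\tfrac{\partial u}{\partial x_i}dx\Big)x_i ,$$ and $\pi^\sharp_{\mathcal N}:H^2(\Omega)/\mathcal N\to H^2_{\mathcal N}(\Omega)$ by $\pi_{\mathcal N}=\pi^\sharp_{\mathcal N}\circ p$. Let $\mathcal P_\sigma:H^2_{\mathcal N}(\Omega)\to F(\Omega)$, $\mathcal P_\sigma[u][\varphi]=\mathcal A_\sigma(u,\varphi)$; let $i:H^2(\Omega)\to L^2(\Omega)$ be the embedding; let $Q$ be the orthogonal projection of $L^2(\Omega)$ onto $\{f\in L^2(\Omega):\int_\Omega f\,dx=\int_\Omega f x_i\,dx=0,\ i=1,\dots,N\}$; and let $\mathcal J[f][\varphi]=\int_\Omega f\varphi\,dx$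 for $f\in L^2(\Omega)$, $\varphi\in H^2(\Omega)$, so that $\mathcal J\circ Q$ maps into $F(\Omega)$. Then $\pi^\sharp_{\mathcal N}$ and $\mathcal P_\sigma$ are linear homeomorphisms, so that the bounded operator $$T_\sigma=(\pi^\sharp_{\mathcal N})^{-1}\circ\mathcal P_\sigma^{-1}\circ\mathcal J\circ Q\circ i\circ\pi^\sharp_{\mathcal N}$$ on $H^2(\Omega)/\mathcal N$ is well defined; moreover $\langle x,y\rangle_\sigma=\mathcal A_\sigma(\pi^\sharp_{\mathcal N}x,\pi^\sharp_{\mathcal N}y)$ is a scalar product on $H^2(\Omega)/\mathcal N$ whose norm is equivalent to the quotient norm, and the following hold. 1. $T_\sigma$ is nonnegative, compact and self-adjoint on $H^2(\Omega)/\mathcal N$ with respect to $\langle\cdot,\cdot\rangle_\sigma$, and the set of its (real) eigenvalues is the set of reciprocals of the positive Neumann eigenvalues. 2. The set of Neumann eigenvalues is contained in $[0,+\infty[$ and is the set of terms of a strictly increasing infinite sequence tending to $+\infty$; each eigenvalue has finite multiplicity. 3. The first eigenvalue is $\lambda=0$. It has multiplicity $N+1$, and $1,x_1,\dots,x_N$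 are linearly independent and generate the space of solutions for $\lambda=0$. -/

import Mathlib

open MeasureTheory Filter Topology
open scoped NNReal ContDiff

noncomputable section

/-- A bounded domain of `ℝ^N`: a bounded connected (in particular nonempty) open set. -/
structure BoundedDomain (N : ℕ) where
  carrier : Set (EuclideanSpace ℝ (Fin N))
  isOpen : IsOpen carrier
  isConnected : IsConnected carrier
  isBounded : Bornology.IsBounded carrier

namespace BoundedDomain

variable {N : ℕ} (Ω : BoundedDomain N)

/-- `Ω` is of class `C^{k,α}`: near each boundary point, and in a direction `e` that may depend on
the point, `Ω` is the open region strictly above the graph of a `C^{k,α}` function `γ` of the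
projection `x - ⟪e, x⟫ e` of `x` to the hyperplane `e^⊥`.  (Only the values of `γ` near the
projection of the point matter; a local `C^{k,α}` function always extends to a global one after
a cut-off and composition with the orthogonal projection.) -/
def IsOfClass (k : ℕ) (α : ℝ≥0) : Prop :=
  ∀ x₀ ∈ frontier Ω.carrier, ∃ (r : ℝ) (e : EuclideanSpace ℝ (Fin N))
    (γ : EuclideanSpace ℝ (Fin N) → ℝ) (C : ℝ≥0),
    0 < r ∧ ‖e‖ = 1 ∧ ContDiff ℝ k γ ∧ HolderWith C α (iteratedFDeriv ℝ k γ) ∧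
    ∀ x ∈ Metric.ball x₀ r, (x ∈ Ω.carrier ↔ γ (x - inner ℝ e x • e) < inner ℝ e x)

/-- Lebesgue measure on `Ω`. -/
abbrev vol : Measure (EuclideanSpace ℝ (Fin N)) := volume.restrict Ω.carrier

/-- The real Hilbert space `L²(Ω)`. -/
abbrev L2 : Type := Lp ℝ 2 Ω.vol

/-- `g` is the weak (distributional) partial derivative `∂f/∂x_i` in `Ω`. -/
def IsWeakPartial (i : Fin N) (f g : Ω.L2) : Prop :=
  ∀ φ : EuclideanSpace ℝ (Fin N) → ℝ, ContDiff ℝ ∞ φ → HasCompactSupport φ →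
    tsupport φ ⊆ Ω.carrier →
    ∫ x in Ω.carrier, f x * fderiv ℝ φ x (EuclideanSpace.single i 1)
      = - ∫ x in Ω.carrier, g x * φ x

/-- Hilbert sum of `1 + N + N²` copies of `L²(Ω)`, indexed by the derivatives of order `0, 1, 2`. -/
abbrev Jet : Type := PiLp 2 (fun _ : Unit ⊕ Fin N ⊕ (Fin N × Fin N) => Ω.L2)

/-! ### Elementary facts needed to see that `H²(Ω)` is a vector space containing `1`, `x_i` -/

instance : IsFiniteMeasure Ω.vol :=
  ⟨by simpa using Ω.isBounded.measure_lt_top⟩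

theorem measurableSet : MeasurableSet Ω.carrier := Ω.isOpen.measurableSet

theorem integrable_mul_test (f : Ω.L2) {g : EuclideanSpace ℝ (Fin N) → ℝ}
    (hg : Continuous g) (hc : HasCompactSupport g) :
    Integrable (fun x => f x * g x) Ω.vol := by
  have h1 : MemLp g 2 Ω.vol := (hg.memLp_of_hasCompactSupport hc)
  exact (Lp.memLp f).integrable_mul h1

theorem continuous_partial {φ : EuclideanSpace ℝ (Fin N) → ℝ} (h : ContDiff ℝ ∞ φ)
    (v : EuclideanSpace ℝ (Fin N)) : Continuous fun x => fderiv ℝ φ x v :=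
  (h.continuous_fderiv (by simp)).clm_apply continuous_const

theorem hasCompactSupport_partial {φ : EuclideanSpace ℝ (Fin N) → ℝ} (h : HasCompactSupport φ)
    (v : EuclideanSpace ℝ (Fin N)) : HasCompactSupport fun x => fderiv ℝ φ x v :=
  h.fderiv_apply (𝕜 := ℝ) v

variable {Ω}

theorem IsWeakPartial.add {i : Fin N} {f g f' g' : Ω.L2} (h : Ω.IsWeakPartial i f g)
    (h' : Ω.IsWeakPartial i f' g') : Ω.IsWeakPartial i (f + f') (g + g') := by
  intro φ h1 h2 h3
  have e1 : ∫ x in Ω.carrier, (f + f') x * fderiv ℝ φ x (EuclideanSpace.single i 1)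
      = ∫ x in Ω.carrier, (f x * fderiv ℝ φ x (EuclideanSpace.single i 1)
        + f' x * fderiv ℝ φ x (EuclideanSpace.single i 1)) := by
    apply integral_congr_ae
    filter_upwards [Lp.coeFn_add f f'] with x hx
    rw [hx, Pi.add_apply, add_mul]
  have e2 : ∫ x in Ω.carrier, (g + g') x * φ x
      = ∫ x in Ω.carrier, (g x * φ x + g' x * φ x) := by
    apply integral_congr_ae
    filter_upwards [Lp.coeFn_add g g'] with x hx
    rw [hx, Pi.add_apply, add_mul]
  have c1 := continuous_partial h1 (EuclideanSpace.single i 1)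
  have c2 := hasCompactSupport_partial h2 (EuclideanSpace.single i (1 : ℝ))
  rw [e1, e2, integral_add (Ω.integrable_mul_test f c1 c2) (Ω.integrable_mul_test f' c1 c2),
    integral_add (Ω.integrable_mul_test g h1.continuous h2)
      (Ω.integrable_mul_test g' h1.continuous h2), h φ h1 h2 h3, h' φ h1 h2 h3]
  ring

theorem IsWeakPartial.smul {i : Fin N} {f g : Ω.L2} (c : ℝ) (h : Ω.IsWeakPartial i f g) :
    Ω.IsWeakPartial i (c • f) (c • g) := by
  intro φ h1 h2 h3
  have e1 : ∫ x in Ω.carrier, (c • f) x * fderiv ℝ φ x (EuclideanSpace.single i 1)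
      = ∫ x in Ω.carrier, c * (f x * fderiv ℝ φ x (EuclideanSpace.single i 1)) := by
    apply integral_congr_ae
    filter_upwards [Lp.coeFn_smul c f] with x hx
    rw [hx, Pi.smul_apply, smul_eq_mul, mul_assoc]
  have e2 : ∫ x in Ω.carrier, (c • g) x * φ x = ∫ x in Ω.carrier, c * (g x * φ x) := by
    apply integral_congr_ae
    filter_upwards [Lp.coeFn_smul c g] with x hx
    rw [hx, Pi.smul_apply, smul_eq_mul, mul_assoc]
  rw [e1, e2, integral_const_mul, integral_const_mul, h φ h1 h2 h3]
  ring

theorem isWeakPartial_of_contDiff {F : EuclideanSpace ℝ (Fin N) → ℝ} (hF : ContDiff ℝ ∞ F)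
    {i : Fin N} {f g : Ω.L2} (hf : f =ᵐ[Ω.vol] F)
    (hg : g =ᵐ[Ω.vol] fun x => fderiv ℝ F x (EuclideanSpace.single i 1)) :
    Ω.IsWeakPartial i f g := by
  intro φ h1 h2 h3
  have c0 := continuous_partial hF (EuclideanSpace.single i 1)
  have c1 := continuous_partial h1 (EuclideanSpace.single i 1)
  have c2 := hasCompactSupport_partial h2 (EuclideanSpace.single i (1 : ℝ))
  have z : ∀ x, x ∉ Ω.carrier → φ x = 0 := fun x hx =>
    image_eq_zero_of_notMem_tsupport fun h => hx (h3 h)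
  have z' : ∀ x, x ∉ Ω.carrier → fderiv ℝ φ x (EuclideanSpace.single i 1) = 0 := by
    intro x hx
    have : x ∉ tsupport (fderiv ℝ φ) := fun h => hx (h3 (tsupport_fderiv_subset ℝ h))
    rw [image_eq_zero_of_notMem_tsupport this]; rfl
  have e1 : ∫ x in Ω.carrier, f x * fderiv ℝ φ x (EuclideanSpace.single i 1)
      = ∫ x, F x * fderiv ℝ φ x (EuclideanSpace.single i 1) := by
    rw [← setIntegral_eq_integral_of_forall_compl_eq_zero (s := Ω.carrier) (μ := volume)
      (f := fun x => F x * fderiv ℝ φ x (EuclideanSpace.single i 1))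
      (fun x hx => by rw [z' x hx, mul_zero])]
    refine integral_congr_ae ?_
    filter_upwards [hf] with x hx
    rw [hx]
  have e2 : ∫ x in Ω.carrier, g x * φ x
      = ∫ x, fderiv ℝ F x (EuclideanSpace.single i 1) * φ x := by
    rw [← setIntegral_eq_integral_of_forall_compl_eq_zero (s := Ω.carrier) (μ := volume)
      (f := fun x => fderiv ℝ F x (EuclideanSpace.single i 1) * φ x)
      (fun x hx => by rw [z x hx, mul_zero])]
    refine integral_congr_ae ?_
    filter_upwards [hg] with x hx
    rw [hx]
  rw [e1, e2]
  exact integral_mul_fderiv_eq_neg_fderiv_mul_of_integrable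
    ((c0.mul h1.continuous).integrable_of_hasCompactSupport h2.mul_left)
    ((hF.continuous.mul c1).integrable_of_hasCompactSupport c2.mul_left)
    ((hF.continuous.mul h1.continuous).integrable_of_hasCompactSupport h2.mul_left)
    (fun x _ => hF.differentiable (by simp) x) (fun x _ => h1.differentiable (by simp) x)

theorem isWeakPartial_zero (i : Fin N) : Ω.IsWeakPartial i 0 0 := by
  refine isWeakPartial_of_contDiff (F := fun _ => 0) contDiff_const (Lp.coeFn_zero _ _ _) ?_
  refine (Lp.coeFn_zero ℝ 2 Ω.vol).trans (Eventually.of_forall fun x => ?_)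
  simp

variable (Ω)

/-! ### The Sobolev space `H²(Ω)` -/

/-- The Sobolev space `H²(Ω)`: an element is a function `u ∈ L²(Ω)` together with its weak
derivatives `∂u/∂x_i` and `∂²u/∂x_i∂x_j`, which are required to lie in `L²(Ω)` (they are uniquely
determined by `u`).  The inner product inherited from `Jet` is the standard one,
`∫ u v + ∑ ∫ ∂_i u ∂_i v + ∑ ∫ ∂_i∂_j u ∂_i∂_j v`. -/
def H2 : Submodule ℝ Ω.Jet where
  carrier := {U | (∀ i, Ω.IsWeakPartial i (U (Sum.inl ())) (U (Sum.inr (Sum.inl i)))) ∧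
    ∀ i j, Ω.IsWeakPartial j (U (Sum.inr (Sum.inl i))) (U (Sum.inr (Sum.inr (i, j))))}
  zero_mem' := ⟨fun i => isWeakPartial_zero i, fun _ j => isWeakPartial_zero j⟩
  add_mem' h h' := ⟨fun i => (h.1 i).add (h'.1 i), fun i j => (h.2 i j).add (h'.2 i j)⟩
  smul_mem' c _ h := ⟨fun i => (h.1 i).smul c, fun i j => (h.2 i j).smul c⟩

/-- The embedding `i : H²(Ω) → L²(Ω)`. -/
def incl : Ω.H2 →L[ℝ] Ω.L2 :=
  (PiLp.proj 2 (fun _ => Ω.L2) (Sum.inl ())) ∘L Ω.H2.subtypeL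

/-- `u ↦ ∂u/∂x_i`. -/
def grad (i : Fin N) : Ω.H2 →L[ℝ] Ω.L2 :=
  (PiLp.proj 2 (fun _ => Ω.L2) (Sum.inr (Sum.inl i))) ∘L Ω.H2.subtypeL

/-- `u ↦ ∂²u/∂x_i∂x_j`. -/
def hess (i j : Fin N) : Ω.H2 →L[ℝ] Ω.L2 :=
  (PiLp.proj 2 (fun _ => Ω.L2) (Sum.inr (Sum.inr (i, j)))) ∘L Ω.H2.subtypeL

/-- The Laplacian `u ↦ Δu = ∑_i ∂²u/∂x_i²`. -/
def lap : Ω.H2 →L[ℝ] Ω.L2 := ∑ i, Ω.hess i i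

/-! ### The functions `1, x_1, …, x_N` and the space `𝒩` they generate -/

/-- The constant function `1` in `L²(Ω)`. -/
def oneL2 : Ω.L2 := (memLp_const (1 : ℝ) : MemLp (fun _ => (1 : ℝ)) 2 Ω.vol).toLp

theorem oneL2_ae : Ω.oneL2 =ᵐ[Ω.vol] fun _ => 1 := MemLp.coeFn_toLp _

theorem memLp_coord (i : Fin N) :
    MemLp (fun x : EuclideanSpace ℝ (Fin N) => x i) 2 Ω.vol := by
  obtain ⟨R, hR⟩ := Ω.isBounded.exists_norm_le
  have hc : Continuous fun x : EuclideanSpace ℝ (Fin N) => x i := by fun_prop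
  refine MemLp.of_bound hc.aestronglyMeasurable R ?_
  filter_upwards [ae_restrict_mem Ω.measurableSet] with x hx
  exact (PiLp.norm_apply_le x i).trans (hR x hx)

/-- The coordinate function `x_i` in `L²(Ω)`. -/
def coordL2 (i : Fin N) : Ω.L2 := (Ω.memLp_coord i).toLp

theorem coordL2_ae (i : Fin N) : Ω.coordL2 i =ᵐ[Ω.vol] fun x => x i := MemLp.coeFn_toLp _

/-- The constant function `1` as an element of `H²(Ω)`. -/
def one : Ω.H2 :=
  ⟨WithLp.toLp 2 (Sum.elim (fun _ => Ω.oneL2) (fun _ => 0)), by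
    refine ⟨fun i => ?_, fun _ j => isWeakPartial_zero j⟩
    refine isWeakPartial_of_contDiff (F := fun _ => 1) contDiff_const
      Ω.oneL2_ae ?_
    refine (Lp.coeFn_zero ℝ 2 Ω.vol).trans (Eventually.of_forall fun x => ?_)
    simp⟩

/-- The coordinate function `x_k` as an element of `H²(Ω)`. -/
def coord (k : Fin N) : Ω.H2 :=
  ⟨WithLp.toLp 2 (Sum.elim (fun _ => Ω.coordL2 k)
      (Sum.elim (fun i => if i = k then Ω.oneL2 else 0) (fun _ => 0))), by
    refine ⟨fun i => ?_, fun i j => ?_⟩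
    · refine isWeakPartial_of_contDiff (F := fun x => EuclideanSpace.proj (𝕜 := ℝ) k x)
        (ContinuousLinearMap.contDiff _) (Ω.coordL2_ae k) ?_
      simp only [ContinuousLinearMap.fderiv]
      by_cases h : i = k
      · subst h
        simp only [Sum.elim_inr, Sum.elim_inl, if_true]
        refine Ω.oneL2_ae.trans (Eventually.of_forall fun x => ?_)
        simp
      · simp only [Sum.elim_inr, Sum.elim_inl, if_neg h]
        refine (Lp.coeFn_zero ℝ 2 Ω.vol).trans (Eventually.of_forall fun x => ?_)
        simp [Ne.symm h]
    · by_cases h : i = k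
      · simp only [Sum.elim_inr, Sum.elim_inl, if_pos h]
        exact Ω.one.2.1 j
      · simp only [Sum.elim_inr, Sum.elim_inl, if_neg h]
        exact isWeakPartial_zero j⟩

/-- The functions `1, x_1, …, x_N` of `H²(Ω)`, in this order. -/
def affineBasis : Fin (N + 1) → Ω.H2 := Fin.cons Ω.one Ω.coord

/-- The subspace `𝒩` of `H²(Ω)` generated by `1, x_1, …, x_N`. -/
def calN : Submodule ℝ Ω.H2 := Submodule.span ℝ (Set.range Ω.affineBasis)

/-! ### Mean values, the space `H²_𝒩(Ω)` and the projection `π_𝒩` -/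

/-- `f ↦ ∫_Ω f dx` on `L²(Ω)`. -/
def integL : Ω.L2 →L[ℝ] ℝ := innerSL ℝ Ω.oneL2

theorem inner_eq_integral (f g : Ω.L2) : inner ℝ f g = ∫ x in Ω.carrier, f x * g x := by
  rw [L2.inner_def]
  refine integral_congr_ae (Eventually.of_forall fun x => ?_)
  simp [mul_comm]

theorem integL_apply (f : Ω.L2) : Ω.integL f = ∫ x in Ω.carrier, f x := by
  change inner ℝ Ω.oneL2 f = _
  rw [inner_eq_integral]
  apply integral_congr_ae
  filter_upwards [Ω.oneL2_ae] with x hx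
  rw [hx, one_mul]

/-- `H²_𝒩(Ω) = {u ∈ H²(Ω) : ∫_Ω u = ∫_Ω ∂u/∂x_i = 0 for all i}`. -/
def H2N : Submodule ℝ Ω.H2 where
  carrier := {u | ∫ x in Ω.carrier, Ω.incl u x = 0 ∧
    ∀ i, ∫ x in Ω.carrier, Ω.grad i u x = 0}
  zero_mem' := by simp [← integL_apply]
  add_mem' := by
    simp only [← integL_apply]
    exact fun h h' => ⟨by rw [map_add, map_add, h.1, h'.1, add_zero],
      fun i => by rw [map_add, map_add, h.2 i, h'.2 i, add_zero]⟩
  smul_mem' := by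
    simp only [← integL_apply]
    exact fun c u h => ⟨by rw [map_smul, map_smul, h.1, smul_zero],
      fun i => by rw [map_smul, map_smul, h.2 i, smul_zero]⟩

/-- The volume `|Ω|`. -/
def volR : ℝ := volume.real Ω.carrier

/-- `u ↦ u - |Ω|⁻¹ ∫u + |Ω|⁻² ∑_i (∫ ∂_i u) (∫ x_i) - |Ω|⁻¹ ∑_i (∫ ∂_i u) x_i` on `H²(Ω)`; see
`piNH2_apply`. -/
def piNH2 : Ω.H2 →L[ℝ] Ω.H2 :=
  ContinuousLinearMap.id ℝ Ω.H2
    - Ω.volR⁻¹ • (Ω.integL ∘L Ω.incl).smulRight Ω.one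
    + (Ω.volR ^ 2)⁻¹ • ∑ i, (Ω.integL (Ω.coordL2 i)) •
        (Ω.integL ∘L Ω.grad i).smulRight Ω.one
    - Ω.volR⁻¹ • ∑ i, (Ω.integL ∘L Ω.grad i).smulRight (Ω.coord i)

theorem integL_coordL2 (i : Fin N) : Ω.integL (Ω.coordL2 i) = ∫ x in Ω.carrier, x i := by
  rw [integL_apply]
  exact integral_congr_ae (Ω.coordL2_ae i)

theorem piNH2_apply (u : Ω.H2) : Ω.piNH2 u = u
    - (Ω.volR⁻¹ * ∫ x in Ω.carrier, Ω.incl u x) • Ω.one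
    + ((Ω.volR ^ 2)⁻¹ * ∑ i, (∫ x in Ω.carrier, Ω.grad i u x) * ∫ x in Ω.carrier, x i) • Ω.one
    - Ω.volR⁻¹ • ∑ i, (∫ x in Ω.carrier, Ω.grad i u x) • Ω.coord i := by
  simp only [← integL_apply, ← integL_coordL2]
  have e : Ω.piNH2 u = u - Ω.volR⁻¹ • Ω.integL (Ω.incl u) • Ω.one
      + (Ω.volR ^ 2)⁻¹ • ∑ i, Ω.integL (Ω.coordL2 i) • Ω.integL (Ω.grad i u) • Ω.one
      - Ω.volR⁻¹ • ∑ i, Ω.integL (Ω.grad i u) • Ω.coord i := by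
    simp [piNH2]
  rw [e, smul_smul, mul_smul _ (∑ i, _), Finset.sum_smul]
  congr 4
  funext i
  rw [smul_smul, mul_comm]

theorem volR_ne_zero : Ω.volR ≠ 0 := by
  have h1 : 0 < volume Ω.carrier := Ω.isOpen.measure_pos _ Ω.isConnected.nonempty
  exact (ENNReal.toReal_pos h1.ne' Ω.isBounded.measure_lt_top.ne).ne'

theorem integL_oneL2 : Ω.integL Ω.oneL2 = Ω.volR := by
  rw [integL_apply, integral_congr_ae Ω.oneL2_ae]
  simp [volR]

@[simp] theorem incl_one : Ω.incl Ω.one = Ω.oneL2 := rfl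
@[simp] theorem incl_coord (i : Fin N) : Ω.incl (Ω.coord i) = Ω.coordL2 i := rfl
@[simp] theorem grad_one (i : Fin N) : Ω.grad i Ω.one = 0 := rfl
@[simp] theorem grad_coord (i k : Fin N) :
    Ω.grad i (Ω.coord k) = if i = k then Ω.oneL2 else 0 := rfl
@[simp] theorem hess_one (i j : Fin N) : Ω.hess i j Ω.one = 0 := rfl
@[simp] theorem hess_coord (i j k : Fin N) : Ω.hess i j (Ω.coord k) = 0 := rfl

theorem piNH2_mem (u : Ω.H2) : Ω.piNH2 u ∈ Ω.H2N := by
  have hv := Ω.volR_ne_zero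
  refine ⟨?_, fun i => ?_⟩
  · rw [piNH2_apply]
    simp only [← integL_apply, ← integL_coordL2]
    simp only [map_sub, map_add, map_smul, map_sum, incl_one, incl_coord, integL_oneL2, smul_eq_mul]
    field_simp
    ring
  · rw [piNH2_apply]
    simp only [← integL_apply, ← integL_coordL2]
    simp only [map_sub, map_add, map_smul, map_sum, grad_one, grad_coord, map_zero, smul_eq_mul,
      apply_ite Ω.integL, integL_oneL2, mul_ite, mul_zero, Finset.sum_ite_eq, Finset.mem_univ,
      if_true]
    field_simp
    ring

/-- The projection `π_𝒩 : H²(Ω) → H²_𝒩(Ω)`. -/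
def piN : Ω.H2 →L[ℝ] Ω.H2N := Ω.piNH2.codRestrict Ω.H2N Ω.piNH2_mem

theorem calN_le_ker_piN : Ω.calN ≤ LinearMap.ker (Ω.piN : Ω.H2 →ₗ[ℝ] Ω.H2N) := by
  have hv := Ω.volR_ne_zero
  refine Submodule.span_le.2 ?_
  rintro _ ⟨k, rfl⟩
  refine LinearMap.mem_ker.2 (Subtype.ext ?_)
  change Ω.piNH2 _ = 0
  rw [piNH2_apply]
  simp only [← integL_apply, ← integL_coordL2]
  refine Fin.cases ?_ (fun k => ?_) k
  · simp [affineBasis, integL_oneL2, hv]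
  · simp only [affineBasis, Fin.cons_succ, incl_coord, grad_coord, apply_ite Ω.integL, integL_oneL2,
      map_zero, ite_mul, zero_mul, ite_smul, zero_smul, Finset.sum_ite_eq', Finset.mem_univ,
      if_true, smul_smul, inv_mul_cancel₀ hv, one_smul]
    have : (Ω.volR ^ 2)⁻¹ * (Ω.volR * Ω.integL (Ω.coordL2 k))
        = Ω.volR⁻¹ * Ω.integL (Ω.coordL2 k) := by field_simp
    rw [this]
    abel

/-- The map `π_𝒩^♯ : H²(Ω)/𝒩 → H²_𝒩(Ω)` with `π_𝒩 = π_𝒩^♯ ∘ p`. -/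
def piSharp : (Ω.H2 ⧸ Ω.calN) →L[ℝ] Ω.H2N := Ω.calN.liftQL Ω.piN Ω.calN_le_ker_piN

/-! ### The quadratic form, and the operators `𝒫_σ`, `𝒥` and `T_σ` -/

/-- The bilinear form
`∫_Ω (1-σ) D²u : D²φ + σ Δu Δφ dx` on `H²(Ω)`. -/
def energy (σ : ℝ) (u φ : Ω.H2) : ℝ :=
  ∫ x in Ω.carrier, ((1 - σ) * (∑ i, ∑ j, Ω.hess i j u x * Ω.hess i j φ x)
    + σ * (Ω.lap u x * Ω.lap φ x))

/-- The bilinear map `(u, φ) ↦ ∫_Ω (S u) (S φ) dx`. -/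
def pairL (S : Ω.H2 →L[ℝ] Ω.L2) : Ω.H2 →L[ℝ] StrongDual ℝ Ω.H2 :=
  (isBoundedBilinearMap_inner (𝕜 := ℝ) (E := Ω.L2)).toContinuousLinearMap.bilinearComp S S

/-- `energy` as a continuous bilinear map; see `energyL_apply`. -/
def energyL (σ : ℝ) : Ω.H2 →L[ℝ] StrongDual ℝ Ω.H2 :=
  (1 - σ) • (∑ i, ∑ j, Ω.pairL (Ω.hess i j)) + σ • Ω.pairL Ω.lap

theorem integrable_mul_L2 (f g : Ω.L2) : Integrable (fun x => f x * g x) Ω.vol :=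
  (Lp.memLp f).integrable_mul (Lp.memLp g)

theorem energyL_apply (σ : ℝ) (u φ : Ω.H2) : Ω.energyL σ u φ = Ω.energy σ u φ := by
  have h : ∀ S : Ω.H2 →L[ℝ] Ω.L2, Ω.pairL S u φ = ∫ x in Ω.carrier, S u x * S φ x := fun S =>
    Ω.inner_eq_integral (S u) (S φ)
  have e : Ω.energyL σ u φ = (1 - σ) * (∑ i, ∑ j, Ω.pairL (Ω.hess i j) u φ)
      + σ * Ω.pairL Ω.lap u φ := by
    simp [energyL, ]
  rw [e, energy]
  simp only [h]
  rw [integral_add, integral_const_mul, integral_const_mul, integral_finsetSum]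
  · congr 2
    refine Finset.sum_congr rfl fun i _ => ?_
    rw [integral_finsetSum]
    exact fun j _ => Ω.integrable_mul_L2 _ _
  · exact fun i _ => integrable_finsetSum _ fun j _ => Ω.integrable_mul_L2 _ _
  · exact (integrable_finsetSum _ fun i _ =>
      integrable_finsetSum _ fun j _ => Ω.integrable_mul_L2 _ _).const_mul _
  · exact (Ω.integrable_mul_L2 _ _).const_mul _

/-- `F(Ω) = {G ∈ H²(Ω)' : G[1] = G[x_i] = 0 for all i}`. -/
def F : Submodule ℝ (StrongDual ℝ Ω.H2) where
  carrier := {G | G Ω.one = 0 ∧ ∀ i, G (Ω.coord i) = 0}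
  zero_mem' := ⟨rfl, fun _ => rfl⟩
  add_mem' h h' := ⟨by simp [h.1, h'.1], fun i => by simp [h.2 i, h'.2 i]⟩
  smul_mem' c _ h := ⟨by simp [h.1], fun i => by simp [h.2 i]⟩

theorem energyL_mem_F (σ : ℝ) (u : Ω.H2) : Ω.energyL σ u ∈ Ω.F := by
  have e : ∀ φ, (∀ i j, Ω.hess i j φ = 0) → Ω.energyL σ u φ = 0 := by
    intro φ h
    have h' : Ω.lap φ = 0 := by simp [lap, h]
    have p : ∀ S : Ω.H2 →L[ℝ] Ω.L2, S φ = 0 → Ω.pairL S u φ = 0 := by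
      intro S hS
      change inner ℝ (S u) (S φ) = 0
      rw [hS, inner_zero_right]
    simp [energyL, p _ (h _ _), p _ h']
  exact ⟨e _ fun _ _ => rfl, fun i => e _ fun _ _ => rfl⟩

/-- The operator `𝒫_σ : H²_𝒩(Ω) → F(Ω)`,
`𝒫_σ[u][φ] = ∫_Ω (1-σ) D²u : D²φ + σ Δu Δφ dx`. -/
def calP (σ : ℝ) : Ω.H2N →L[ℝ] Ω.F :=
  (Ω.energyL σ ∘L Ω.H2N.subtypeL).codRestrict Ω.F fun u => Ω.energyL_mem_F σ u

/-- The map `𝒥 : L²(Ω) → H²(Ω)'`, `𝒥[f][φ] = ∫_Ω f φ dx`; see `calJ_apply`. -/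
def calJ : Ω.L2 →L[ℝ] StrongDual ℝ Ω.H2 :=
  (isBoundedBilinearMap_inner (𝕜 := ℝ) (E := Ω.L2)).toContinuousLinearMap.bilinearComp
    (ContinuousLinearMap.id ℝ Ω.L2) Ω.incl

theorem calJ_apply (f : Ω.L2) (φ : Ω.H2) :
    Ω.calJ f φ = ∫ x in Ω.carrier, f x * Ω.incl φ x :=
  Ω.inner_eq_integral f (Ω.incl φ)

/-- The subspace of `L²(Ω)` generated by `1, x_1, …, x_N`. -/
def affL2 : Submodule ℝ Ω.L2 := Submodule.span ℝ (Set.range fun k => Ω.incl (Ω.affineBasis k))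

instance : FiniteDimensional ℝ Ω.affL2 := FiniteDimensional.span_of_finite ℝ (Set.finite_range _)

/-- The orthogonal projection `Q` of `L²(Ω)` onto the orthogonal complement
`{f : ∫ f = ∫ f x_i = 0 for all i}` of the affine functions. -/
def Q : Ω.L2 →L[ℝ] Ω.affL2ᗮ := Ω.affL2ᗮ.orthogonalProjectionOnto

theorem calJ_mem_F (f : Ω.affL2ᗮ) : Ω.calJ f ∈ Ω.F := by
  have h : ∀ k, Ω.calJ f (Ω.affineBasis k) = 0 := fun k =>
    Submodule.inner_left_of_mem_orthogonal (Submodule.subset_span (Set.mem_range_self k)) f.2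
  exact ⟨h 0, fun i => h i.succ⟩

/-- The restriction of `𝒥` to `{f : ∫ f = ∫ f x_i = 0}`, whose values lie in `F(Ω)`. -/
def calJF : Ω.affL2ᗮ →L[ℝ] Ω.F :=
  (Ω.calJ ∘L Ω.affL2ᗮ.subtypeL).codRestrict Ω.F Ω.calJ_mem_F

/-- The operator
`T_σ = (π_𝒩^♯)^{-1} ∘ 𝒫_σ^{-1} ∘ 𝒥 ∘ Q ∘ i ∘ π_𝒩^♯` on `H²(Ω)/𝒩`.  The projection `Q` brings the
functional `𝒥[i[u]]` into the domain `F(Ω)` of `𝒫_σ^{-1}`. -/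
def T (σ : ℝ) : (Ω.H2 ⧸ Ω.calN) →L[ℝ] (Ω.H2 ⧸ Ω.calN) :=
  Ω.piSharp.inverse ∘L (Ω.calP σ).inverse ∘L Ω.calJF ∘L Ω.Q ∘L Ω.incl ∘L
    Ω.H2N.subtypeL ∘L Ω.piSharp

/-- The scalar product on `H²(Ω)/𝒩` transported by `π_𝒩^♯` from `H²_𝒩(Ω)`, where it is the
bilinear form `energy`. -/
def scalarProd (σ : ℝ) (x y : Ω.H2 ⧸ Ω.calN) : ℝ :=
  Ω.energy σ (Ω.piSharp x : Ω.H2) (Ω.piSharp y : Ω.H2)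

/-! ### The weak Neumann eigenvalue problem -/

/-- The space of all `u ∈ H²(Ω)` with
`∫_Ω (1-σ) D²u : D²φ + σ Δu Δφ dx = lam ∫_Ω u φ dx` for all `φ ∈ H²(Ω)`. -/
def neumannEigenspace (σ lam : ℝ) : Submodule ℝ Ω.H2 where
  carrier := {u | ∀ φ : Ω.H2,
    Ω.energy σ u φ = lam * ∫ x in Ω.carrier, Ω.incl u x * Ω.incl φ x}
  zero_mem' φ := by
    rw [← energyL_apply, ← inner_eq_integral, map_zero, map_zero, inner_zero_left, mul_zero]
    rfl
  add_mem' := by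
    intro u v hu hv φ
    have h1 := hu φ
    have h2 := hv φ
    simp only [← energyL_apply, ← inner_eq_integral] at h1 h2 ⊢
    rw [map_add, map_add, inner_add_left, add_apply, h1, h2, mul_add]
  smul_mem' := by
    intro c u hu φ
    have h1 := hu φ
    simp only [← energyL_apply, ← inner_eq_integral] at h1 ⊢
    rw [map_smul, map_smul, real_inner_smul_left, smul_apply, h1, smul_eq_mul]
    ring

/-- `lam` is an eigenvalue of the weak Neumann problem: it has a solution `u ≠ 0`. -/
def IsNeumannEigenvalue (σ lam : ℝ) : Prop :=
  ∃ u ∈ Ω.neumannEigenspace σ lam, u ≠ 0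

end BoundedDomain

end

/-! For `0 ≤ σ < 1` the form dominates `(1 - σ)` times the squared `L²` norm of the Hessian, so
everything rests on compactness. Rellich's theorem is proved by hand. On a compact subset of `Ω`, a
function differs from its average over small translates by a small multiple of its gradient norm,
and finitely many orthogonality relations make that average small
(`exists_finset_eLpNorm_restrict_le`). Near the boundary, a short shift along the direction of the
local graph pushes `Ω` into a compact subset of itself, again at the cost of a small multiple of the
gradient norm (`IsOfClass.exists_finset_norm_le`). Hence `u ↦ u` and `u ↦ ∂u/∂x_i` are compact from
`H²(Ω)` to `L²(Ω)`.

By connectedness, zero Hessian and the mean value conditions of `H²_𝒩(Ω)` force `u = 0`. With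
compactness this gives a Poincaré inequality, so the form is coercive on `H²_𝒩(Ω)`
(`IsOfClass.exists_le_energyL`), and Lax–Milgram inverts `𝒫_σ`. The identity `⟨T x, y⟩ = (Q i π x, Q
i π y)` in `L²(Ω)` yields symmetry and nonnegativity of `T_σ`; compactness comes from `i`. An
eigenvector of `T_σ` becomes a Neumann eigenfunction once its affine `L²` component is removed, and
conversely the class of a Neumann eigenfunction with positive eigenvalue is an eigenvector of `T_σ`.

The sequence of eigenvalues is obtained from the form plus the `L²` scalar product, which is
coercive on all of `H²(Ω)`. Its solution operator is compact and symmetric on `L²(Ω)`. The spectral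
theorem and the infinite dimension of `L²(Ω)` give infinitely many eigenvalues
(`infinite_setOf_eigenvalue`), and compactness excludes infinitely many below a bound
(`finite_setOf_eigenvalue_le`). Zero energy means that `u` is affine, which describes the eigenvalue
`0`. -/

noncomputable section

namespace BoundedDomain

/-! ### Duality in `L²` -/

section

/-- A square integrable function on an open set `A` whose integral against every test function
`ψ` supported in `A` is bounded by `M ‖ψ‖` has `L²(A)` norm at most `M`. -/
theorem eLpNorm_le_of_abs_integral_test_le {E : Type*} [NormedAddCommGroup E]
    [InnerProductSpace ℝ E] [FiniteDimensional ℝ E] [MeasurableSpace E] [BorelSpace E]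
    {A : Set E} (hA : IsOpen A) {h : E → ℝ} (hh : MemLp h 2 (volume.restrict A)) {M : ℝ}
    (hM : 0 ≤ M)
    (H : ∀ ψ : E → ℝ, ContDiff ℝ ∞ ψ → HasCompactSupport ψ → tsupport ψ ⊆ A →
      |∫ x in A, h x * ψ x| ≤ M * (eLpNorm ψ 2 (volume.restrict A)).toReal) :
    eLpNorm h 2 (volume.restrict A) ≤ ENNReal.ofReal M := by
  set μ := (volume.restrict A : Measure E)
  let S : Submodule ℝ (Lp ℝ 2 μ) :=
    { carrier := {f | ∃ ψ : E → ℝ, ContDiff ℝ ∞ ψ ∧ HasCompactSupport ψ ∧ tsupport ψ ⊆ A ∧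
        f =ᵐ[μ] ψ}
      zero_mem' := ⟨0, contDiff_const, HasCompactSupport.zero, by simp, Lp.coeFn_zero _ _ _⟩
      add_mem' := by
        rintro f f' ⟨ψ, h1, h2, h3, h4⟩ ⟨ψ', h1', h2', h3', h4'⟩
        refine ⟨ψ + ψ', h1.add h1', h2.add h2',
          (tsupport_add ψ ψ').trans (Set.union_subset h3 h3'), ?_⟩
        exact (Lp.coeFn_add f f').trans (h4.add h4')
      smul_mem' := by
        rintro c f ⟨ψ, h1, h2, h3, h4⟩
        refine ⟨c • ψ, h1.const_smul c, h2.smul_left (f := fun _ => c),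
          (closure_mono (Function.support_const_smul_subset c ψ)).trans h3, ?_⟩
        exact (Lp.coeFn_smul c f).trans (h4.const_smul c) }
  have inner_eq : ∀ f g : Lp ℝ 2 μ, inner ℝ f g = ∫ x, f x * g x ∂μ := by
    intro f g
    rw [L2.inner_def]
    exact integral_congr_ae (Eventually.of_forall fun x => by simp [mul_comm])
  -- Test functions are dense: a function orthogonal to all of them vanishes by the fundamental
  -- lemma of the calculus of variations.
  have hdense : S.topologicalClosure = ⊤ := by
    rw [Submodule.topologicalClosure_eq_top_iff, Submodule.eq_bot_iff]
    intro f hf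
    have h0 : ∀ᵐ x ∂(volume : Measure E), x ∈ A → f x = 0 := by
      refine hA.ae_eq_zero_of_integral_contDiff_smul_eq_zero ?_ ?_
      · exact locallyIntegrableOn_of_locallyIntegrable_restrict
          ((Lp.memLp f).locallyIntegrable (by norm_num))
      · intro g g1 g2 g3
        have gm : MemLp g 2 μ := g1.continuous.memLp_of_hasCompactSupport g2
        have := (Submodule.mem_orthogonal _ _).1 hf gm.toLp ⟨g, g1, g2, g3, gm.coeFn_toLp⟩
        rw [inner_eq] at this
        rw [← setIntegral_eq_integral_of_forall_compl_eq_zero (s := A), ← this]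
        · refine integral_congr_ae ?_
          filter_upwards [gm.coeFn_toLp] with x hx
          rw [hx, smul_eq_mul]
        · intro x hx
          rw [image_eq_zero_of_notMem_tsupport fun h => hx (g3 h), zero_smul]
    rw [Lp.eq_zero_iff_ae_eq_zero]
    exact (ae_restrict_iff' hA.measurableSet).2 h0
  have key : ∀ f : Lp ℝ 2 μ, |inner ℝ hh.toLp f| ≤ M * ‖f‖ := by
    have hcl : IsClosed {f : Lp ℝ 2 μ | |inner ℝ hh.toLp f| ≤ M * ‖f‖} :=
      isClosed_le (by fun_prop) (by fun_prop)
    intro f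
    have hf : f ∈ closure (S : Set (Lp ℝ 2 μ)) := by
      rw [← Submodule.topologicalClosure_coe, hdense]; trivial
    refine closure_minimal ?_ hcl hf
    rintro f ⟨ψ, h1, h2, h3, h4⟩
    have := H ψ h1 h2 h3
    rw [← eLpNorm_congr_ae h4, ← Lp.norm_def] at this
    rw [Set.mem_ofPred_eq]
    rw [inner_eq]
    convert this using 2
    refine integral_congr_ae ?_
    filter_upwards [hh.coeFn_toLp, h4] with x hx hx'
    rw [hx, hx']
  -- By density the bound holds for every `f`; taking `f = h` gives `‖h‖² ≤ M ‖h‖`.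
  have := key hh.toLp
  rw [real_inner_self_eq_norm_sq, abs_of_nonneg (sq_nonneg _), sq] at this
  rw [← eLpNorm_congr_ae hh.coeFn_toLp, ← Lp.enorm_def, ← ofReal_norm]
  refine ENNReal.ofReal_le_ofReal ?_
  rcases (norm_nonneg hh.toLp).eq_or_lt with h0 | h0
  · exact h0 ▸ hM
  · exact le_of_mul_le_mul_right this h0

end

/-! ### Extension by zero and translates -/

section

variable {N : ℕ} {Ω : BoundedDomain N}

/-- Extension by zero of a function in `L²(Ω)`. -/
def zeroExt (f : Ω.L2) : EuclideanSpace ℝ (Fin N) → ℝ := Ω.carrier.indicator f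

theorem stronglyMeasurable_zeroExt (f : Ω.L2) : StronglyMeasurable (zeroExt f) :=
  (Lp.stronglyMeasurable f).indicator Ω.measurableSet

theorem memLp_zeroExt (f : Ω.L2) : MemLp (zeroExt f) 2 volume :=
  (memLp_indicator_iff_restrict Ω.measurableSet).2 (Lp.memLp f)

theorem eLpNorm_zeroExt (f : Ω.L2) : eLpNorm (zeroExt f) 2 volume = ENNReal.ofReal ‖f‖ := by
  rw [zeroExt, eLpNorm_indicator_eq_eLpNorm_restrict Ω.measurableSet, ofReal_norm, Lp.enorm_def]

theorem integrable_zeroExt (f : Ω.L2) : Integrable (zeroExt f) volume :=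
  (integrable_indicator_iff Ω.measurableSet).2 ((Lp.memLp f).integrable (by norm_num))

theorem zeroExt_mul (f : Ω.L2) (φ : EuclideanSpace ℝ (Fin N) → ℝ) :
    (fun x => zeroExt f x * φ x) = Ω.carrier.indicator fun x => f x * φ x := by
  funext x
  by_cases hx : x ∈ Ω.carrier <;> simp [zeroExt, hx]

theorem integral_zeroExt_mul (f : Ω.L2) (φ : EuclideanSpace ℝ (Fin N) → ℝ) :
    ∫ x, zeroExt f x * φ x = ∫ x in Ω.carrier, f x * φ x := by
  rw [zeroExt_mul, integral_indicator Ω.measurableSet]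

/-- Expanding `y` in the standard basis turns the partial derivatives into a directional one, the
form in which translations along `y` need it. -/
theorem IsWeakPartial.integral_zeroExt_mul_fderiv {f : Ω.L2} {g : Fin N → Ω.L2}
    (h : ∀ i, Ω.IsWeakPartial i f (g i)) {φ : EuclideanSpace ℝ (Fin N) → ℝ}
    (h1 : ContDiff ℝ ∞ φ) (h2 : HasCompactSupport φ) (h3 : tsupport φ ⊆ Ω.carrier)
    (y : EuclideanSpace ℝ (Fin N)) :
    ∫ x, zeroExt f x * fderiv ℝ φ x y = - ∫ x, zeroExt (∑ i, y i • g i) x * φ x := by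
  rw [integral_zeroExt_mul, integral_zeroExt_mul]
  have e1 : ∀ x, f x * fderiv ℝ φ x y
      = ∑ i, y i * (f x * fderiv ℝ φ x (EuclideanSpace.single i 1)) := by
    intro x
    have hy : y = ∑ i, y i • EuclideanSpace.single i (1 : ℝ) := by
      ext j; simp [Pi.single_apply]
    conv_lhs => rw [hy]
    rw [map_sum, Finset.mul_sum]
    refine Finset.sum_congr rfl fun i _ => ?_
    rw [map_smul, smul_eq_mul]; ring
  have gm : MemLp φ 2 Ω.vol := h1.continuous.memLp_of_hasCompactSupport h2
  have e2 : ∀ g : Ω.L2, ∫ x in Ω.carrier, g x * φ x = inner ℝ gm.toLp g := by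
    intro g
    rw [real_inner_comm, inner_eq_integral]
    refine integral_congr_ae ?_
    filter_upwards [gm.coeFn_toLp] with x hx
    rw [hx]
  simp only [e1]
  rw [integral_finsetSum, e2, inner_sum, ← Finset.sum_neg_distrib]
  · refine Finset.sum_congr rfl fun i _ => ?_
    rw [integral_const_mul, h i φ h1 h2 h3, e2, real_inner_smul_right]
    ring
  · exact fun i _ => (Ω.integrable_mul_test f (continuous_partial h1 _)
      (hasCompactSupport_partial h2 _)).const_mul _

theorem norm_sum_smul_le (y : EuclideanSpace ℝ (Fin N)) (g : Fin N → Ω.L2) :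
    ‖∑ i, y i • g i‖ ≤ ‖y‖ * ∑ i, ‖g i‖ := by
  rw [Finset.mul_sum]
  refine norm_sum_le_of_le _ fun i _ => ?_
  rw [norm_smul]
  exact mul_le_mul_of_nonneg_right (PiLp.norm_apply_le y i) (norm_nonneg _)

theorem abs_integral_mul_le {E : Type*} [MeasurableSpace E] {μ : Measure E} {f g : E → ℝ}
    (hf : MemLp f 2 μ) (hg : MemLp g 2 μ) :
    |∫ x, f x * g x ∂μ| ≤ (eLpNorm f 2 μ).toReal * (eLpNorm g 2 μ).toReal := by
  have := abs_real_inner_le_norm hf.toLp hg.toLp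
  rw [L2.inner_def, Lp.norm_toLp, Lp.norm_toLp] at this
  convert this using 2
  refine integral_congr_ae ?_
  filter_upwards [hf.coeFn_toLp, hg.coeFn_toLp] with x hx hx'
  rw [hx, hx']
  simp [mul_comm]

/-- Translations of a function with weak derivatives in `L²(Ω)`, on a set whose translates stay
in `Ω`. -/
theorem eLpNorm_translate_sub_le {f : Ω.L2} {g : Fin N → Ω.L2}
    (h : ∀ i, Ω.IsWeakPartial i f (g i)) {A : Set (EuclideanSpace ℝ (Fin N))} (hA : IsOpen A)
    {y : EuclideanSpace ℝ (Fin N)} (hy : ∀ x ∈ A, ∀ t ∈ Set.Icc (0 : ℝ) 1, x + t • y ∈ Ω.carrier) :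
    eLpNorm (fun x => zeroExt f (x + y) - zeroExt f x) 2 (volume.restrict A)
      ≤ ENNReal.ofReal (‖y‖ * ∑ i, ‖g i‖) := by
  have hF := memLp_zeroExt f
  have hFy : MemLp (fun x => zeroExt f (x + y)) 2 volume :=
    hF.comp_measurePreserving (measurePreserving_add_right volume y)
  refine eLpNorm_le_of_abs_integral_test_le hA ((hFy.sub hF).restrict A) (by positivity) ?_
  intro ψ h1 h2 h3
  have z : ∀ x, x ∉ A → ψ x = 0 := fun x hx =>
    image_eq_zero_of_notMem_tsupport fun h => hx (h3 h)
  have hψA : eLpNorm ψ 2 (volume.restrict A) = eLpNorm ψ 2 volume :=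
    eLpNorm_restrict_eq_of_support_subset fun x hx => by
      by_contra hc; exact hx (z x hc)
  have hψ : MemLp ψ 2 volume := h1.continuous.memLp_of_hasCompactSupport h2
  rw [hψA, setIntegral_eq_integral_of_forall_compl_eq_zero
    (fun x hx => by rw [z x hx, mul_zero])]
  -- The translation is moved onto the smooth factor, so `Φ` is differentiable although `f` is not,
  -- and `Φ 1 - Φ 0` is the integral to be bounded. For `t` in `[0, 1)` the translate of `ψ` is
  -- still supported in `Ω`, so the weak derivative bounds `Φ'` and the mean value inequality
  -- concludes.
  set Φ : ℝ → ℝ := fun t => ∫ x, zeroExt f x * ψ (x - t • y) with hΦ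
  have hdiff : ∀ t, HasDerivAt Φ (∫ x, zeroExt f x * -(fderiv ℝ ψ (x - t • y) y)) t := by
    intro t
    obtain ⟨C, hC⟩ := (hasCompactSupport_partial h2 y).exists_bound_of_continuous
      (continuous_partial h1 y)
    have cs : ∀ s : ℝ, Continuous fun x : EuclideanSpace ℝ (Fin N) => x - s • y := by
      intro s; fun_prop
    refine (hasDerivAt_integral_of_dominated_loc_of_deriv_le (s := Set.univ)
      (bound := fun x => ‖zeroExt f x‖ * C)
      (F' := fun t x => zeroExt f x * -(fderiv ℝ ψ (x - t • y) y)) univ_mem ?_ ?_ ?_ ?_ ?_ ?_).2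
    · exact Eventually.of_forall fun s => (stronglyMeasurable_zeroExt f).aestronglyMeasurable.mul
        (h1.continuous.comp (cs s)).aestronglyMeasurable
    · exact hF.integrable_mul
        (hψ.comp_measurePreserving (measurePreserving_sub_right volume (t • y)))
    · exact (stronglyMeasurable_zeroExt f).aestronglyMeasurable.mul
        ((continuous_partial h1 y).comp (cs t)).neg.aestronglyMeasurable
    · refine Eventually.of_forall fun x s _ => ?_
      rw [norm_mul, norm_neg]
      exact mul_le_mul_of_nonneg_left (hC _) (norm_nonneg _)
    · exact (integrable_zeroExt f).norm.mul_const C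
    · refine Eventually.of_forall fun x s _ => ?_
      have e1 : HasDerivAt (fun s : ℝ => x - s • y) (-y) s := by
        simpa using ((hasDerivAt_id s).smul_const y).const_sub x
      have e2 := ((h1.differentiable (by simp)) (x - s • y)).hasFDerivAt.comp_hasDerivAt s e1
      rw [map_neg] at e2
      exact e2.const_mul (zeroExt f x)
  have hbound : ∀ t ∈ Set.Ico (0 : ℝ) 1, ‖∫ x, zeroExt f x * -(fderiv ℝ ψ (x - t • y) y)‖
      ≤ ‖y‖ * (∑ i, ‖g i‖) * (eLpNorm ψ 2 volume).toReal := by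
    intro t ht
    set φ : EuclideanSpace ℝ (Fin N) → ℝ := fun x => ψ (x - t • y)
    have φ1 : ContDiff ℝ ∞ φ := h1.comp (contDiff_id.sub contDiff_const)
    have φ2 : HasCompactSupport φ := h2.comp_homeomorph (Homeomorph.subRight (t • y))
    have φ3 : tsupport φ ⊆ Ω.carrier := by
      have hs : tsupport φ ⊆ (Homeomorph.subRight (t • y)) ⁻¹' tsupport ψ :=
        closure_minimal (fun x hx => subset_tsupport ψ hx)
          ((isClosed_tsupport ψ).preimage (Homeomorph.continuous _))
      intro x hx
      have := hy _ (h3 (hs hx)) t ⟨ht.1, ht.2.le⟩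
      simpa using this
    have φ4 : ∀ x, fderiv ℝ ψ (x - t • y) y = fderiv ℝ φ x y := by
      intro x
      simp only [φ]; rw [fderiv_comp_sub (f := ψ)]
    have φ5 : eLpNorm φ 2 volume = eLpNorm ψ 2 volume :=
      eLpNorm_comp_measurePreserving hψ.aestronglyMeasurable
        (measurePreserving_sub_right volume (t • y))
    have φ6 : MemLp φ 2 volume := φ1.continuous.memLp_of_hasCompactSupport φ2
    simp only [φ4, mul_neg]
    rw [integral_neg, IsWeakPartial.integral_zeroExt_mul_fderiv h φ1 φ2 φ3 y, neg_neg]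
    refine (abs_integral_mul_le (memLp_zeroExt _) φ6).trans ?_
    rw [φ5, eLpNorm_zeroExt, ENNReal.toReal_ofReal (norm_nonneg _)]
    exact mul_le_mul_of_nonneg_right (norm_sum_smul_le y g) ENNReal.toReal_nonneg
  have main := norm_image_sub_le_of_norm_deriv_le_segment_01'
    (fun t _ => (hdiff t).hasDerivWithinAt) hbound
  convert main using 2
  simp only [hΦ, one_smul, zero_smul, sub_zero]
  have e : ∫ x, zeroExt f x * ψ (x - y) = ∫ x, zeroExt f (x + y) * ψ x := by
    rw [← integral_add_right_eq_self (fun x => zeroExt f x * ψ (x - y)) y]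
    simp
  have e' := integral_sub (hFy.integrable_mul hψ) (hF.integrable_mul hψ)
  simp only [Pi.mul_apply] at e'
  rw [e, ← e']
  simp only [Pi.sub_apply, sub_mul, Real.norm_eq_abs]

end

/-! ### Approximation on compact sets -/

section

variable {N : ℕ} {Ω : BoundedDomain N}

/-- Averaging translates of `f` against a probability density of small support changes `f` little
in `L²(A)`, if `A` stays away from the boundary. -/
theorem eLpNorm_average_sub_le {f : Ω.L2} {g : Fin N → Ω.L2}
    (h : ∀ i, Ω.IsWeakPartial i f (g i)) {A : Set (EuclideanSpace ℝ (Fin N))} (hA : IsOpen A)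
    {η : ℝ} (hη : ∀ x ∈ A, ∀ y, ‖y‖ < η → x + y ∈ Ω.carrier)
    (P : Measure (EuclideanSpace ℝ (Fin N))) [IsProbabilityMeasure P] (hP : ∀ᵐ y ∂P, ‖y‖ < η)
    (hint : ∀ x, Integrable (fun y => zeroExt f (x + y)) P) :
    eLpNorm (fun x => (∫ y, zeroExt f (x + y) ∂P) - zeroExt f x) 2 (volume.restrict A)
      ≤ ENNReal.ofReal (η * ∑ i, ‖g i‖) := by
  have hFm : Measurable (zeroExt f) := (stronglyMeasurable_zeroExt f).measurable
  have hsq : ∀ (μ : Measure (EuclideanSpace ℝ (Fin N))) (u : EuclideanSpace ℝ (Fin N) → ℝ),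
      (eLpNorm u 2 μ) ^ 2 = ∫⁻ x, ‖u x‖ₑ ^ 2 ∂μ := by
    intro μ u
    have := eLpNorm_nnreal_pow_eq_lintegral (f := u) (μ := μ) (p := 2) (by norm_num)
    simpa only [NNReal.coe_ofNat, ENNReal.coe_ofNat, ENNReal.rpow_ofNat] using this
  -- Jensen's inequality: for a probability measure the `L¹` norm is at most the `L²` norm. Tonelli
  -- then reduces the claim to one translate at a time.
  have hp : ∀ x, ‖(∫ y, zeroExt f (x + y) ∂P) - zeroExt f x‖ₑ ^ 2
      ≤ ∫⁻ y, ‖zeroExt f (x + y) - zeroExt f x‖ₑ ^ 2 ∂P := by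
    intro x
    have e : (∫ y, zeroExt f (x + y) ∂P) - zeroExt f x
        = ∫ y, (zeroExt f (x + y) - zeroExt f x) ∂P := by
      rw [integral_sub (hint x) (integrable_const _)]; simp
    rw [e, ← hsq]
    gcongr
    refine (enorm_integral_le_lintegral_enorm _).trans ?_
    rw [← eLpNorm_one_eq_lintegral_enorm]
    exact eLpNorm_le_eLpNorm_of_exponent_le (by norm_num)
      ((hFm.comp (measurable_const_add x)).sub_const _).aestronglyMeasurable
  have hpow : (eLpNorm (fun x => (∫ y, zeroExt f (x + y) ∂P) - zeroExt f x) 2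
      (volume.restrict A)) ^ 2 ≤ (ENNReal.ofReal (η * ∑ i, ‖g i‖)) ^ 2 := by
    rw [hsq]
    calc ∫⁻ x in A, ‖(∫ y, zeroExt f (x + y) ∂P) - zeroExt f x‖ₑ ^ 2
        ≤ ∫⁻ x in A, ∫⁻ y, ‖zeroExt f (x + y) - zeroExt f x‖ₑ ^ 2 ∂P := lintegral_mono hp
      _ = ∫⁻ y, (∫⁻ x in A, ‖zeroExt f (x + y) - zeroExt f x‖ₑ ^ 2) ∂P := by
          refine lintegral_lintegral_swap ?_
          refine Measurable.aemeasurable ?_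
          exact ((hFm.comp (measurable_fst.add measurable_snd)).sub
            (hFm.comp measurable_fst)).enorm.pow_const 2
      _ ≤ ∫⁻ _, (ENNReal.ofReal (η * ∑ i, ‖g i‖)) ^ 2 ∂P := by
          refine lintegral_mono_ae ?_
          filter_upwards [hP] with y hy
          rw [← hsq]
          gcongr
          refine (eLpNorm_translate_sub_le h hA fun x hx t ht => hη x hx _ ?_).trans ?_
          · rw [norm_smul, Real.norm_eq_abs, abs_of_nonneg ht.1]
            exact (mul_le_of_le_one_left (norm_nonneg y) ht.2).trans_lt hy
          · gcongr
      _ = _ := by simp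
  exact (ENNReal.pow_right_strictMono two_ne_zero).le_iff_le.1 hpow

/-- On compact subsets of `Ω`, finitely many orthogonality relations make the `L²` norm small
compared with the `H¹` norm. -/
theorem exists_finset_eLpNorm_restrict_le {K : Set (EuclideanSpace ℝ (Fin N))} (hK : IsCompact K)
    (hKΩ : K ⊆ Ω.carrier) {ε : ℝ} (hε : 0 < ε) :
    ∃ W : Finset Ω.L2, ∀ (f : Ω.L2) (g : Fin N → Ω.L2), (∀ i, Ω.IsWeakPartial i f (g i)) →
      (∀ w ∈ W, inner ℝ f w = 0) →
      eLpNorm (zeroExt f) 2 (volume.restrict K) ≤ ENNReal.ofReal (ε * (‖f‖ + ∑ i, ‖g i‖)) := by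
  classical
  obtain ⟨δ, hδ, hδΩ⟩ := hK.exists_thickening_subset_open Ω.isOpen hKΩ
  -- `δ / 2` keeps translates of the `δ / 2`-neighbourhood of `K` inside `Ω`; `ε` bounds the error
  -- made by averaging.
  set η := min (δ / 2) ε with hηdef
  have hη : 0 < η := lt_min (by positivity) hε
  let b : ContDiffBump (0 : EuclideanSpace ℝ (Fin N)) := ⟨η / 2, η, by positivity, by linarith⟩
  set ρ := b.normed volume with hρ
  have ρc : Continuous ρ := b.continuous_normed
  have ρs : HasCompactSupport ρ := b.hasCompactSupport_normed
  have ρuc : UniformContinuous ρ := ρs.uniformContinuous_of_continuous ρc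
  set P : Measure (EuclideanSpace ℝ (Fin N)) := volume.withDensity fun y => ENNReal.ofReal (ρ y)
  have hρm : Measurable fun y => ENNReal.ofReal (ρ y) := ρc.measurable.ennreal_ofReal
  have hPp : IsProbabilityMeasure P := by
    refine ⟨?_⟩
    rw [withDensity_apply _ MeasurableSet.univ, Measure.restrict_univ,
      ← ofReal_integral_eq_lintegral_ofReal b.integrable_normed
      (Eventually.of_forall b.nonneg_normed), b.integral_normed, ENNReal.ofReal_one]
  have hP : ∀ᵐ y ∂P, ‖y‖ < η := by
    rw [ae_withDensity_iff hρm]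
    refine Eventually.of_forall fun y hy => ?_
    have : y ∈ Function.support ρ := fun h0 => hy (by rw [h0, ENNReal.ofReal_zero])
    rw [b.support_normed_eq] at this
    simpa using this
  have hPint : ∀ u : EuclideanSpace ℝ (Fin N) → ℝ, ∫ y, u y ∂P = ∫ y, u y * ρ y := by
    intro u
    rw [integral_withDensity_eq_integral_toReal_smul hρm (by simp)]
    refine integral_congr_ae (Eventually.of_forall fun y => ?_)
    simp only [smul_eq_mul]
    rw [ENNReal.toReal_ofReal (b.nonneg_normed y), mul_comm]
  have ρm : ∀ p, MemLp (fun z => ρ (z - p)) 2 Ω.vol := fun p =>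
    ((ρc.memLp_of_hasCompactSupport ρs (μ := volume) (p := 2)).comp_measurePreserving
      (measurePreserving_sub_right volume p)).restrict _
  set V := (Ω.vol Set.univ ^ (2 : ℝ)⁻¹).toReal with hV
  have hV0 : 0 ≤ V := ENNReal.toReal_nonneg
  -- `V = |Ω|^{1/2}` enters twice: in Cauchy–Schwarz for the values of the average, then in passing
  -- from their supremum to the `L²` norm on `K`.
  set ε' := ε / (1 + V * V) with hε'
  have hε'0 : 0 < ε' := by positivity
  obtain ⟨r, hr, hr'⟩ := Metric.uniformContinuous_iff.1 ρuc ε' hε'0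
  obtain ⟨t, htK, ht⟩ := hK.elim_finite_subcover_image (b := K) (c := fun p => Metric.ball p r)
    (fun _ _ => Metric.isOpen_ball) (fun x hx => Set.mem_biUnion hx (Metric.mem_ball_self hr))
  refine ⟨ht.1.toFinset.image fun p => (ρm p).toLp, fun f g h hW => ?_⟩
  have hF := memLp_zeroExt f
  have hFm : Measurable (zeroExt f) := (stronglyMeasurable_zeroExt f).measurable
  have hmx : ∀ x, ∫ y, zeroExt f (x + y) ∂P = ∫ z in Ω.carrier, f z * ρ (z - x) := by
    intro x
    rw [hPint, ← integral_zeroExt_mul,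
      ← integral_add_right_eq_self (fun z => zeroExt f z * ρ (z - x)) x]
    simp [add_comm]
  -- The average at a net point `p` is the pairing of `f` with `ρ(· - p)`, which vanishes by the
  -- choice of `W`. Uniform continuity of `ρ` carries smallness to the other points of `K`.
  have hmK : ∀ x ∈ K, |∫ y, zeroExt f (x + y) ∂P| ≤ ‖f‖ * (V * ε') := by
    intro x hx
    obtain ⟨p, hp, hxp⟩ := Set.mem_iUnion₂.1 (ht.2 hx)
    have h0 : ∫ z in Ω.carrier, f z * ρ (z - p) = 0 := by
      have := hW (ρm p).toLp (Finset.mem_image_of_mem _ (ht.1.mem_toFinset.2 hp))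
      rw [inner_eq_integral] at this
      rw [← this]
      refine integral_congr_ae ?_
      filter_upwards [(ρm p).coeFn_toLp] with z hz
      rw [hz]
    have e := integral_sub ((Lp.memLp f).integrable_mul (ρm x)) ((Lp.memLp f).integrable_mul (ρm p))
    simp only [Pi.mul_apply, ← mul_sub] at e
    rw [hmx, ← sub_zero (∫ z in Ω.carrier, f z * ρ (z - x)), ← h0, ← e]
    refine (abs_integral_mul_le (Lp.memLp f) ((ρm x).sub (ρm p))).trans ?_
    rw [← Lp.norm_def]
    gcongr
    have hb : ∀ᵐ z ∂Ω.vol, ‖ρ (z - x) - ρ (z - p)‖ ≤ ε' := by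
      refine Eventually.of_forall fun z => ?_
      rw [← dist_eq_norm]
      refine (hr' ?_).le
      rw [dist_sub_left]
      exact hxp
    have := eLpNorm_le_of_ae_bound (p := 2) hb
    refine (ENNReal.toReal_mono ?_ this).trans ?_
    · exact ENNReal.mul_ne_top (ENNReal.rpow_ne_top_of_nonneg (by norm_num) (measure_ne_top _ _))
        ENNReal.ofReal_ne_top
    · rw [ENNReal.toReal_mul, ENNReal.toReal_ofReal hε'0.le, hV]
      simp
  -- The averaging estimate is available on open sets, so `K` is enlarged slightly.
  set A := Metric.thickening (δ / 2) K
  have hA : IsOpen A := Metric.isOpen_thickening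
  have hKA : K ⊆ A := Metric.self_subset_thickening (by positivity) K
  have hAη : ∀ x ∈ A, ∀ y, ‖y‖ < η → x + y ∈ Ω.carrier := by
    intro x hx y hy
    obtain ⟨k, hk, hxk⟩ := Metric.mem_thickening_iff.1 hx
    refine hδΩ (Metric.mem_thickening_iff.2 ⟨k, hk, ?_⟩)
    calc dist (x + y) k ≤ dist (x + y) x + dist x k := dist_triangle _ _ _
      _ < δ / 2 + δ / 2 := add_lt_add (by
          rw [dist_eq_norm, add_sub_cancel_left]; exact hy.trans_le (min_le_left _ _)) hxk
      _ = δ := by ring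
  have hint : ∀ x, Integrable (fun y => zeroExt f (x + y)) P := by
    intro x
    rw [integrable_withDensity_iff_integrable_smul₀' hρm.aemeasurable (by simp)]
    have := (hF.comp_measurePreserving (measurePreserving_add_left volume x)).integrable_mul
      (ρc.memLp_of_hasCompactSupport ρs (μ := volume) (p := 2))
    refine this.congr (Eventually.of_forall fun y => ?_)
    simp only [smul_eq_mul, Pi.mul_apply, Function.comp_apply]
    rw [ENNReal.toReal_ofReal (b.nonneg_normed y), mul_comm]
  have hav := eLpNorm_average_sub_le h hA hAη P hP hint
  have hmm : StronglyMeasurable fun x => ∫ y, zeroExt f (x + y) ∂P :=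
    StronglyMeasurable.integral_prod_right
      (hFm.comp (measurable_fst.add measurable_snd)).stronglyMeasurable
  have h1 : eLpNorm (fun x => (∫ y, zeroExt f (x + y) ∂P) - zeroExt f x) 2 (volume.restrict K)
      ≤ ENNReal.ofReal (ε * ∑ i, ‖g i‖) := by
    refine ((eLpNorm_mono_measure _ (Measure.restrict_mono hKA le_rfl)).trans hav).trans ?_
    gcongr
    exact min_le_right _ _
  have h2 : eLpNorm (fun x => ∫ y, zeroExt f (x + y) ∂P) 2 (volume.restrict K)
      ≤ ENNReal.ofReal (ε * ‖f‖) := by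
    refine (eLpNorm_le_of_ae_bound (p := 2) (C := ‖f‖ * (V * ε')) ?_).trans ?_
    · filter_upwards [ae_restrict_mem hK.measurableSet] with x hx using hmK x hx
    · have hle : (volume.restrict K) Set.univ ≤ Ω.vol Set.univ := by
        simpa using measure_mono hKΩ
      calc _ ≤ (Ω.vol Set.univ ^ (2 : ℝ)⁻¹) * ENNReal.ofReal (‖f‖ * (V * ε')) := by
            refine mul_le_mul' ?_ le_rfl
            exact ENNReal.rpow_le_rpow hle (by norm_num)
        _ = ENNReal.ofReal (V * (‖f‖ * (V * ε'))) := by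
            rw [ENNReal.ofReal_mul hV0, hV, ENNReal.ofReal_toReal]
            exact ENNReal.rpow_ne_top_of_nonneg (by norm_num) (measure_ne_top _ _)
        _ ≤ _ := by
            refine ENNReal.ofReal_le_ofReal ?_
            have : V * V * ε' ≤ ε := by
              rw [hε', mul_div_assoc', div_le_iff₀ (by positivity)]
              nlinarith
            nlinarith [norm_nonneg f]
  have e : zeroExt f = (fun x => ∫ y, zeroExt f (x + y) ∂P)
      - fun x => (∫ y, zeroExt f (x + y) ∂P) - zeroExt f x := by
    funext x; simp
  rw [e]
  refine (eLpNorm_sub_le hmm.aestronglyMeasurable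
    (hmm.sub (stronglyMeasurable_zeroExt f)).aestronglyMeasurable (by norm_num)).trans ?_
  refine (add_le_add h2 h1).trans ?_
  rw [← ENNReal.ofReal_add (by positivity) (by positivity), mul_add]

end

/-! ### Functions with vanishing weak gradient -/

section

variable {N : ℕ} {Ω : BoundedDomain N}

/-- With zero gradient the translation estimate gives `f(x + y) = f(x)` for each `y` and almost
every `x`. Fubini exchanges the quantifiers, and one good `x` supplies the constant. Points of the
small ball differ by less than `2 * η`, so the segments used stay in the ball of radius `3 * η`. -/
theorem exists_ae_ball_eq_const {f : Ω.L2} (h : ∀ i, Ω.IsWeakPartial i f 0)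
    {x₀ : EuclideanSpace ℝ (Fin N)} {η : ℝ} (hη : 0 < η)
    (hB : Metric.ball x₀ (3 * η) ⊆ Ω.carrier) :
    ∃ c : ℝ, ∀ᵐ z, z ∈ Metric.ball x₀ η → zeroExt f z = c := by
  set B := Metric.ball x₀ η
  have hFm : Measurable (zeroExt f) := (stronglyMeasurable_zeroExt f).measurable
  have h1 : ∀ y, ∀ᵐ x, x ∈ B → x + y ∈ B → zeroExt f (x + y) = zeroExt f x := by
    intro y
    by_cases hy : ‖y‖ < 2 * η
    · have := eLpNorm_translate_sub_le (g := fun _ => 0) h (A := B) Metric.isOpen_ball (y := y) (by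
        intro x hx t ht
        refine hB ?_
        rw [Metric.mem_ball] at hx ⊢
        calc dist (x + t • y) x₀ ≤ dist (x + t • y) x + dist x x₀ := dist_triangle _ _ _
          _ < 2 * η + η := by
            refine add_lt_add ?_ hx
            rw [dist_eq_norm, add_sub_cancel_left, norm_smul, Real.norm_eq_abs, abs_of_nonneg ht.1]
            exact (mul_le_of_le_one_left (norm_nonneg y) ht.2).trans_lt hy
          _ = _ := by ring)
      simp only [norm_zero, Finset.sum_const_zero, mul_zero, ENNReal.ofReal_zero, nonpos_iff_eq_zero]
        at this
      have hm : Measurable fun x => zeroExt f (x + y) - zeroExt f x :=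
        (hFm.comp (measurable_add_const y)).sub hFm
      rw [eLpNorm_eq_zero_iff hm.aestronglyMeasurable (by norm_num)] at this
      have := (ae_restrict_iff' Metric.isOpen_ball.measurableSet).1 this
      filter_upwards [this] with x hx hxB _
      exact sub_eq_zero.1 (hx hxB)
    · refine Eventually.of_forall fun x hx hxy => absurd ?_ hy
      rw [Metric.mem_ball] at hx hxy
      calc ‖y‖ = dist (x + y) x := by rw [dist_eq_norm, add_sub_cancel_left]
        _ ≤ dist (x + y) x₀ + dist x x₀ := dist_triangle_right _ _ _
        _ < 2 * η := by linarith
  have hmeas : MeasurableSet {p : EuclideanSpace ℝ (Fin N) × EuclideanSpace ℝ (Fin N) |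
      p.2 ∈ B → p.2 + p.1 ∈ B → zeroExt f (p.2 + p.1) = zeroExt f p.2} := by
    have hBm : MeasurableSet B := Metric.isOpen_ball.measurableSet
    have hadd : Measurable fun p : EuclideanSpace ℝ (Fin N) × EuclideanSpace ℝ (Fin N) =>
      p.2 + p.1 := measurable_snd.add measurable_fst
    exact (measurable_snd hBm).imp ((hadd hBm).imp
      (measurableSet_eq_fun (hFm.comp hadd) (hFm.comp measurable_snd)))
  have h2 := (Measure.ae_ae_comm (μ := volume) (ν := volume) hmeas).1 (Eventually.of_forall h1)
  have h3 : ∃ x ∈ B, ∀ᵐ y, x ∈ B → x + y ∈ B → zeroExt f (x + y) = zeroExt f x := by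
    by_contra hc
    have h4 : ∀ᵐ x, x ∉ B := by
      filter_upwards [h2] with x hx hxB
      exact hc ⟨x, hxB, hx⟩
    have := measure_eq_zero_iff_ae_notMem.2 h4
    exact (Metric.measure_ball_pos volume x₀ hη).ne' this
  obtain ⟨x, hxB, hx⟩ := h3
  refine ⟨zeroExt f x, ?_⟩
  have := (measurePreserving_sub_right volume x).quasiMeasurePreserving.ae hx
  filter_upwards [this] with z hz hzB
  simpa using hz hxB (by simpa using hzB)

/-- A function on a domain whose weak gradient vanishes is constant. -/
theorem exists_ae_eq_const {f : Ω.L2} (h : ∀ i, Ω.IsWeakPartial i f 0) :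
    ∃ c : ℝ, f = c • Ω.oneL2 := by
  -- The sets `U c`, where `f` is locally a.e. equal to `c`, are open, pairwise disjoint and cover
  -- `Ω`; connectedness leaves only one.
  let U : ℝ → Set (EuclideanSpace ℝ (Fin N)) := fun c =>
    {x | ∃ η > 0, ∀ᵐ z, z ∈ Metric.ball x η → zeroExt f z = c}
  have hUo : ∀ c, IsOpen (U c) := by
    intro c
    rw [Metric.isOpen_iff]
    rintro x ⟨η, hη, hx⟩
    refine ⟨η / 2, by positivity, fun y hy => ⟨η / 2, by positivity, ?_⟩⟩
    filter_upwards [hx] with z hz hzy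
    refine hz ?_
    rw [Metric.mem_ball] at *
    linarith [dist_triangle z y x]
  have hcov : ∀ x ∈ Ω.carrier, ∃ c, x ∈ U c := by
    intro x hx
    obtain ⟨r, hr, hr'⟩ := Metric.isOpen_iff.1 Ω.isOpen x hx
    obtain ⟨c, hc⟩ := exists_ae_ball_eq_const h (x₀ := x) (η := r / 3) (by positivity)
      (by rwa [mul_div_cancel₀ r (by norm_num : (3 : ℝ) ≠ 0)])
    exact ⟨c, r / 3, by positivity, hc⟩
  have hdisj : ∀ x c c', x ∈ U c → x ∈ U c' → c = c' := by
    rintro x c c' ⟨η, hη, h1⟩ ⟨η', hη', h2⟩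
    by_contra hne
    have h4 : ∀ᵐ z, z ∉ Metric.ball x (min η η') := by
      filter_upwards [h1, h2] with z hz hz' hzB
      exact hne ((hz (Metric.ball_subset_ball (min_le_left _ _) hzB)).symm.trans
        (hz' (Metric.ball_subset_ball (min_le_right _ _) hzB)))
    exact (Metric.measure_ball_pos volume x (lt_min hη hη')).ne' (measure_eq_zero_iff_ae_notMem.2 h4)
  obtain ⟨x₀, hx₀⟩ := Ω.isConnected.nonempty
  obtain ⟨c, hc⟩ := hcov x₀ hx₀
  have hsub : Ω.carrier ⊆ U c := by
    refine Ω.isConnected.isPreconnected.subset_left_of_subset_union (hUo c)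
      (isOpen_iUnion fun c' : {c' // c' ≠ c} => hUo c') ?_ ?_ ⟨x₀, hx₀, hc⟩
    · rw [Set.disjoint_left]
      intro x hx hx'
      obtain ⟨c', hc'⟩ := Set.mem_iUnion.1 hx'
      exact c'.2 (hdisj x c' c hc' hx)
    · intro x hx
      obtain ⟨c', hc'⟩ := hcov x hx
      by_cases e : c' = c
      · exact Or.inl (e ▸ hc')
      · exact Or.inr (Set.mem_iUnion.2 ⟨⟨c', e⟩, hc'⟩)
  have hnull : volume {x | x ∈ Ω.carrier ∧ f x ≠ c} = 0 := by
    refine measure_null_of_locally_null _ fun x hx => ?_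
    obtain ⟨η, hη, hx'⟩ := hsub hx.1
    refine ⟨{x | x ∈ Ω.carrier ∧ f x ≠ c} ∩ Metric.ball x η, inter_mem self_mem_nhdsWithin
      (mem_nhdsWithin_of_mem_nhds (Metric.ball_mem_nhds x hη)), ?_⟩
    refine measure_eq_zero_iff_ae_notMem.2 ?_
    filter_upwards [hx'] with z hz hzB
    refine hzB.1.2 ?_
    rw [← hz hzB.2, zeroExt, Set.indicator_of_mem hzB.1.1]
  refine ⟨c, Lp.ext ?_⟩
  have h5 : ∀ᵐ x ∂Ω.vol, f x = c := by
    rw [ae_restrict_iff' Ω.measurableSet]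
    filter_upwards [measure_eq_zero_iff_ae_notMem.1 hnull] with x hx hxΩ
    by_contra hne
    exact hx ⟨hxΩ, hne⟩
  filter_upwards [h5, Lp.coeFn_smul c Ω.oneL2, Ω.oneL2_ae] with x h1 h2 h3
  rw [h1, h2, Pi.smul_apply, h3, smul_eq_mul, mul_one]

/-- Weak derivatives are unique. -/
theorem IsWeakPartial.unique {i : Fin N} {f g g' : Ω.L2} (h : Ω.IsWeakPartial i f g)
    (h' : Ω.IsWeakPartial i f g') : g = g' := by
  have h0 : eLpNorm (⇑(g - g')) 2 (volume.restrict Ω.carrier) ≤ ENNReal.ofReal 0 := by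
    refine eLpNorm_le_of_abs_integral_test_le Ω.isOpen (Lp.memLp (g - g')) le_rfl ?_
    intro φ h1 h2 h3
    have e : ∫ x in Ω.carrier, (g - g') x * φ x
        = ∫ x in Ω.carrier, (g x * φ x - g' x * φ x) := by
      refine integral_congr_ae ?_
      filter_upwards [Lp.coeFn_sub g g'] with x hx
      rw [hx, Pi.sub_apply, sub_mul]
    rw [e, integral_sub (Ω.integrable_mul_test g h1.continuous h2)
      (Ω.integrable_mul_test g' h1.continuous h2)]
    have := (h φ h1 h2 h3).symm.trans (h' φ h1 h2 h3)
    rw [neg_inj.1 this]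
    simp
  rw [ENNReal.ofReal_zero, nonpos_iff_eq_zero] at h0
  rw [← sub_eq_zero, ← norm_eq_zero, Lp.norm_def, h0, ENNReal.toReal_zero]

end

/-! ### Compactness up to the boundary -/

section

/-- The pieces may overlap, so the squared norms are only subadditive; `n a² ≤ (n a)²` with `n ≥ 1`
avoids a square root. -/
theorem eLpNorm_restrict_le_card_mul {E ι : Type*} [MeasurableSpace E] [Fintype ι] [Nonempty ι]
    {μ : Measure E} {F : E → ℝ} {U : Set E} {S : ι → Set E} (hU : U ⊆ ⋃ i, S i) {a : ENNReal}
    (ha : ∀ i, eLpNorm F 2 (μ.restrict (S i)) ≤ a) :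
    eLpNorm F 2 (μ.restrict U) ≤ Fintype.card ι * a := by
  have hsq : ∀ ν : Measure E, (eLpNorm F 2 ν) ^ 2 = ∫⁻ x, ‖F x‖ₑ ^ 2 ∂ν := by
    intro ν
    have := eLpNorm_nnreal_pow_eq_lintegral (f := F) (μ := ν) (p := 2) (by norm_num)
    simpa only [NNReal.coe_ofNat, ENNReal.coe_ofNat, ENNReal.rpow_ofNat] using this
  refine (ENNReal.pow_le_pow_left_iff two_ne_zero).1 ?_
  rw [hsq]
  calc ∫⁻ x in U, ‖F x‖ₑ ^ 2 ∂μ ≤ ∫⁻ x in ⋃ i, S i, ‖F x‖ₑ ^ 2 ∂μ := lintegral_mono_set hU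
    _ ≤ ∑' i, ∫⁻ x in S i, ‖F x‖ₑ ^ 2 ∂μ := lintegral_iUnion_le _ _
    _ = ∑ i, (eLpNorm F 2 (μ.restrict (S i))) ^ 2 := by rw [tsum_fintype]; simp only [hsq]
    _ ≤ ∑ _i : ι, a ^ 2 := Finset.sum_le_sum fun i _ => by gcongr; exact ha i
    _ = Fintype.card ι * a ^ 2 := by rw [Finset.sum_const, nsmul_eq_mul]; rfl
    _ ≤ (Fintype.card ι * a) ^ 2 := by
      rw [mul_pow]
      gcongr
      exact le_self_pow₀ (by exact_mod_cast Fintype.card_pos) two_ne_zero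

variable {N : ℕ} {Ω : BoundedDomain N}

/-- Near a boundary point, a domain of class `C^{k,α}` can be pushed into its interior. -/
theorem IsOfClass.exists_translate_mem {k : ℕ} {α : ℝ≥0} (h : Ω.IsOfClass k α)
    {x₀ : EuclideanSpace ℝ (Fin N)} (hx₀ : x₀ ∈ frontier Ω.carrier) :
    ∃ r : ℝ, 0 < r ∧ ∃ e : EuclideanSpace ℝ (Fin N), ‖e‖ = 1 ∧
      ∀ x ∈ closure Ω.carrier ∩ Metric.closedBall x₀ r, ∀ s, 0 < s → s ≤ r →
        x + s • e ∈ Ω.carrier := by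
  obtain ⟨r, e, γ, C, hr, he, hγ, -, H⟩ := h x₀ hx₀
  refine ⟨r / 3, by positivity, e, he, fun x hx s hs hsr => ?_⟩
  have hxr : dist x x₀ ≤ r / 3 := hx.2
  have hγc : Continuous γ := hγ.continuous
  -- On the closure only the weak inequality survives; the shift by `s > 0` raises the height along
  -- `e`, leaves the projection to the hyperplane unchanged, and makes the inequality strict again.
  have hle : γ (x - inner ℝ e x • e) ≤ inner ℝ e x := by
    have hxcl : x ∈ closure (Metric.ball x₀ r ∩ Ω.carrier) :=
      Metric.isOpen_ball.inter_closure ⟨by rw [Metric.mem_ball]; linarith, hx.1⟩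
    have hcl : IsClosed {x | γ (x - inner ℝ e x • e) ≤ inner ℝ e x} :=
      isClosed_le (by fun_prop) (by fun_prop)
    exact closure_minimal (fun z hz => ((H z hz.1).1 hz.2).le) hcl hxcl
  refine (H _ ?_).2 ?_
  · rw [Metric.mem_ball]
    calc dist (x + s • e) x₀ ≤ dist (x + s • e) x + dist x x₀ := dist_triangle _ _ _
      _ ≤ r / 3 + r / 3 := by
        refine add_le_add ?_ hxr
        rw [dist_eq_norm, add_sub_cancel_left, norm_smul, he, mul_one, Real.norm_eq_abs,
          abs_of_pos hs]
        exact hsr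
      _ < r := by linarith
  · have e1 : inner ℝ e (x + s • e) = inner ℝ e x + s := by
      rw [inner_add_right, real_inner_smul_right, real_inner_self_eq_norm_sq, he]; ring
    have e2 : x + s • e - (inner ℝ e x + s) • e = x - inner ℝ e x • e := by
      rw [add_smul]; abel
    rw [e1, e2]
    linarith

/-- A quantitative form of Rellich's theorem. -/
theorem IsOfClass.exists_finset_norm_le {k : ℕ} {α : ℝ≥0} (hΩ : Ω.IsOfClass k α) {ε : ℝ}
    (hε : 0 < ε) :
    ∃ W : Finset Ω.L2, ∀ (f : Ω.L2) (g : Fin N → Ω.L2), (∀ i, Ω.IsWeakPartial i f (g i)) →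
      (∀ w ∈ W, inner ℝ f w = 0) → ‖f‖ ≤ ε * (‖f‖ + ∑ i, ‖g i‖) := by
  classical
  have hcomp : IsCompact (closure Ω.carrier) := Ω.isBounded.isCompact_closure
  have hfr : IsCompact (frontier Ω.carrier) :=
    hcomp.of_isClosed_subset isClosed_frontier frontier_subset_closure
  choose! r hr e he H using fun x₀ (hx₀ : x₀ ∈ frontier Ω.carrier) => hΩ.exists_translate_mem hx₀
  obtain ⟨t, htf, ht⟩ := hfr.elim_nhds_subcover (fun p => Metric.ball p (r p))
    (fun p hp => Metric.ball_mem_nhds p (hr p hp))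
  set m : ℝ := ((Fintype.card (Option t) : ℕ) : ℝ) with hmdef
  have hm : 0 < m := by rw [hmdef]; exact_mod_cast Fintype.card_pos
  -- Each of the `m` pieces, the boundary patches and the interior remainder, will contribute at
  -- most `2 * ε₁ * R`.
  set ε₁ := ε / (2 * m) with hε₁
  have hε₁0 : 0 < ε₁ := by positivity
  obtain ⟨s, hs, hsr⟩ : ∃ s > 0, ∀ p ∈ t, s ≤ r p := by
    rcases t.eq_empty_or_nonempty with rfl | hne
    · exact ⟨1, one_pos, by simp⟩
    · obtain ⟨p, hp, hmin⟩ := t.exists_min_image r hne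
      exact ⟨r p, hr p (htf p hp), hmin⟩
  -- The bound `s` makes the shift admissible in every patch, and `ε₁` makes the translation error
  -- at most `ε₁ * R`.
  set h := min s ε₁ with hhdef
  have hh : 0 < h := lt_min hs hε₁0
  have hhr : ∀ p ∈ t, h ≤ r p := fun p hp => (min_le_left _ _).trans (hsr p hp)
  set K₀ := closure Ω.carrier \ ⋃ p ∈ t, Metric.ball p (r p)
  set C : EuclideanSpace ℝ (Fin N) → Set (EuclideanSpace ℝ (Fin N)) := fun p =>
    (fun x => x + h • e p) '' (closure Ω.carrier ∩ Metric.closedBall p (r p))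
  -- The interior remainder together with all shifted boundary patches is a compact subset of `Ω`,
  -- where the interior estimate applies.
  set K := K₀ ∪ ⋃ p ∈ t, C p
  have hC : ∀ p, IsCompact (C p) := fun p =>
    (hcomp.inter_right Metric.isClosed_closedBall).image (continuous_add_const _)
  have hK : IsCompact K :=
    (hcomp.diff (isOpen_biUnion fun _ _ => Metric.isOpen_ball)).union
      (t.isCompact_biUnion fun p _ => hC p)
  have hKΩ : K ⊆ Ω.carrier := by
    refine Set.union_subset ?_ (Set.iUnion₂_subset fun p hp => ?_)
    · rintro x ⟨hx, hx'⟩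
      by_contra hc
      exact hx' (ht ⟨hx, fun hi => hc (interior_subset hi)⟩)
    · rintro _ ⟨x, hx, rfl⟩
      exact H p (htf p hp) x hx h hh (hhr p hp)
  obtain ⟨W, hW⟩ := exists_finset_eLpNorm_restrict_le hK hKΩ hε₁0
  refine ⟨W, fun f g hfg horth => ?_⟩
  set R := ‖f‖ + ∑ i, ‖g i‖
  have hR : 0 ≤ R := by positivity
  have hK1 := hW f g hfg horth
  have hF := memLp_zeroExt f
  let S : Option t → Set (EuclideanSpace ℝ (Fin N)) := fun o =>
    o.elim K₀ fun p => Ω.carrier ∩ Metric.ball p (r p)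
  have hcov : Ω.carrier ⊆ ⋃ o, S o := by
    intro x hx
    by_cases hxt : x ∈ ⋃ p ∈ t, Metric.ball p (r p)
    · obtain ⟨p, hp, hxp⟩ := Set.mem_iUnion₂.1 hxt
      exact Set.mem_iUnion.2 ⟨some ⟨p, hp⟩, hx, hxp⟩
    · exact Set.mem_iUnion.2 ⟨none, subset_closure hx, hxt⟩
  have hpiece : ∀ o, eLpNorm (zeroExt f) 2 (volume.restrict (S o))
      ≤ ENNReal.ofReal (2 * (ε₁ * R)) := by
    rintro (_ | ⟨p, hp⟩)
    · refine (eLpNorm_mono_measure _ (Measure.restrict_mono Set.subset_union_left le_rfl)).trans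
        (hK1.trans (ENNReal.ofReal_le_ofReal ?_))
      linarith [mul_nonneg hε₁0.le hR]
    · set A := Ω.carrier ∩ Metric.ball p (r p)
      change eLpNorm (zeroExt f) 2 (volume.restrict A) ≤ _
      have hA : IsOpen A := Ω.isOpen.inter Metric.isOpen_ball
      have hp' := htf p hp
      have hCp : ∀ x ∈ A, x ∈ closure Ω.carrier ∩ Metric.closedBall p (r p) := fun x hx =>
        ⟨subset_closure hx.1, Metric.ball_subset_closedBall hx.2⟩
      have h1 : eLpNorm (fun x => zeroExt f (x + h • e p) - zeroExt f x) 2 (volume.restrict A)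
          ≤ ENNReal.ofReal (ε₁ * R) := by
        refine (eLpNorm_translate_sub_le hfg hA fun x hx τ hτ => ?_).trans
          (ENNReal.ofReal_le_ofReal ?_)
        · rcases hτ.1.eq_or_lt with h0 | h0
          · rw [← h0, zero_smul, add_zero]; exact hx.1
          · rw [smul_smul]
            exact H p hp' x (hCp x hx) _ (mul_pos h0 hh)
              ((mul_le_of_le_one_left hh.le hτ.2).trans (hhr p hp))
        · rw [norm_smul, he p hp', mul_one, Real.norm_eq_abs, abs_of_pos hh]
          refine mul_le_mul (min_le_right _ _) ?_ (by positivity) hε₁0.le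
          exact le_add_of_nonneg_left (norm_nonneg f)
      -- Changing variables, the shifted function on the patch is `f` on `C p ⊆ K`.
      have h2 : eLpNorm (fun x => zeroExt f (x + h • e p)) 2 (volume.restrict A)
          ≤ ENNReal.ofReal (ε₁ * R) := by
        refine le_trans ?_ hK1
        have hCK : C p ⊆ K := (Set.subset_biUnion_of_mem (u := C) hp).trans Set.subset_union_right
        have mp : MeasurePreserving (fun x : EuclideanSpace ℝ (Fin N) => x + h • e p)
            (volume.restrict ((fun x => x + h • e p) ⁻¹' C p)) (volume.restrict (C p)) :=
          (measurePreserving_add_right volume (h • e p)).restrict_preimage (hC p).measurableSet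
        calc _ ≤ eLpNorm (fun x => zeroExt f (x + h • e p)) 2
              (volume.restrict ((fun x => x + h • e p) ⁻¹' C p)) :=
              eLpNorm_mono_measure _ (Measure.restrict_mono
                (show A ⊆ _ ⁻¹' C p from fun x hx => ⟨x, hCp x hx, rfl⟩) le_rfl)
          _ = eLpNorm (zeroExt f) 2 (volume.restrict (C p)) :=
              eLpNorm_comp_measurePreserving
                (stronglyMeasurable_zeroExt f).aestronglyMeasurable mp
          _ ≤ _ := eLpNorm_mono_measure _ (Measure.restrict_mono hCK le_rfl)
      have e3 : zeroExt f = (fun x => zeroExt f (x + h • e p))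
          - fun x => zeroExt f (x + h • e p) - zeroExt f x := by
        funext x; simp
      have hm1 : AEStronglyMeasurable (fun x => zeroExt f (x + h • e p)) (volume.restrict A) :=
        ((stronglyMeasurable_zeroExt f).comp_measurable
          (measurable_add_const (h • e p))).aestronglyMeasurable
      rw [e3]
      refine (eLpNorm_sub_le hm1
        (hm1.sub (stronglyMeasurable_zeroExt f).aestronglyMeasurable) (by norm_num)).trans ?_
      refine (add_le_add h2 h1).trans ?_
      rw [← ENNReal.ofReal_add (by positivity) (by positivity), two_mul]
  have hfin := eLpNorm_restrict_le_card_mul hcov hpiece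
  have hnorm : eLpNorm (zeroExt f) 2 (volume.restrict Ω.carrier) = ENNReal.ofReal ‖f‖ := by
    rw [ofReal_norm, Lp.enorm_def]
    refine eLpNorm_congr_ae ?_
    filter_upwards [ae_restrict_mem Ω.measurableSet] with x hx
    rw [zeroExt, Set.indicator_of_mem hx]
  rw [hnorm, ← ENNReal.ofReal_natCast, ← ENNReal.ofReal_mul (by positivity),
    ENNReal.ofReal_le_ofReal_iff (by positivity)] at hfin
  refine hfin.trans_eq ?_
  change m * (2 * (ε₁ * R)) = ε * R
  rw [hε₁]
  field_simp

/-- A bounded operator between Hilbert spaces which is small on closed subspaces of finite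
codimension is compact. -/
theorem isCompactOperator_of_forall_exists_finset {H G : Type*} [NormedAddCommGroup H]
    [InnerProductSpace ℝ H] [CompleteSpace H] [NormedAddCommGroup G] [InnerProductSpace ℝ G]
    [CompleteSpace G] (T : H →L[ℝ] G)
    (h : ∀ ε > 0, ∃ W : Finset G, ∀ u, (∀ w ∈ W, inner ℝ (T u) w = 0) → ‖T u‖ ≤ ε * ‖u‖) :
    IsCompactOperator T := by
  have hcl : IsClosed {S : H →L[ℝ] G | IsCompactOperator S} := isClosed_setOfPred_isCompactOperator
  refine hcl.closure_subset (Metric.mem_closure_iff.2 fun ε hε => ?_)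
  obtain ⟨W, hW⟩ := h (ε / 2) (by positivity)
  -- If `u ⟂ V` then `T u` is orthogonal to `W`. Hence `T` is within `ε / 2` of the finite rank
  -- operator obtained by projecting onto `V` first.
  let V : Submodule ℝ H := Submodule.span ℝ (T.adjoint '' W)
  have : FiniteDimensional ℝ V :=
    FiniteDimensional.span_of_finite ℝ (W.finite_toSet.image _)
  refine ⟨(T ∘L V.subtypeL) ∘L V.orthogonalProjectionOnto, ?_, ?_⟩
  · have hid : IsCompactOperator (ContinuousLinearMap.id ℝ V) :=
      isCompactOperator_id_iff_finiteDimensional.2 this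
    exact (hid.clm_comp (T ∘L V.subtypeL)).comp_clm V.orthogonalProjectionOnto
  · rw [dist_eq_norm]
    refine (ContinuousLinearMap.opNorm_le_bound _ (half_pos hε).le fun u => ?_).trans_lt
      (half_lt_self hε)
    have hv : u - V.orthogonalProjectionOnto u ∈ Vᗮ := V.sub_starProjection_mem_orthogonal u
    have e : (T - (T ∘L V.subtypeL) ∘L V.orthogonalProjectionOnto) u
        = T (u - V.orthogonalProjectionOnto u) := by simp
    rw [e]
    refine (hW _ fun w hw => ?_).trans ?_
    · rw [← ContinuousLinearMap.adjoint_inner_right]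
      exact Submodule.inner_left_of_mem_orthogonal
        (Submodule.subset_span (Set.mem_image_of_mem _ hw)) hv
    · gcongr
      have := Vᗮ.norm_starProjection_apply_le u
      rwa [Submodule.starProjection_orthogonal_val] at this

end

/-! ### Coercivity on `H²(Ω)` -/

section

theorem isCompactOperator_pi {H ι : Type*} {G : ι → Type*} [Finite ι] [TopologicalSpace H]
    [Zero H] [∀ i, TopologicalSpace (G i)] {T : ∀ i, H → G i}
    (h : ∀ i, IsCompactOperator (T i)) : IsCompactOperator fun u i => T i u := by
  choose K hK hK' using h
  refine ⟨Set.univ.pi K, isCompact_univ_pi hK, ?_⟩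
  have : (fun u i => T i u) ⁻¹' Set.univ.pi K = ⋂ i, T i ⁻¹' K i := by
    ext u; simp
  rw [this]
  exact Filter.iInter_mem.2 hK'

/-- An injective operator which controls the norm up to a compact operator is bounded below. -/
theorem exists_norm_le_of_isCompactOperator {H G G' : Type*} [NormedAddCommGroup H]
    [NormedSpace ℝ H] [CompleteSpace H] [NormedAddCommGroup G] [NormedSpace ℝ G]
    [NormedAddCommGroup G'] [NormedSpace ℝ G'] {K : H →L[ℝ] G} {D : H →L[ℝ] G'}
    (hK : IsCompactOperator K) {a : ℝ} (h : ∀ u, ‖u‖ ≤ a * (‖K u‖ + ‖D u‖))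
    (hD : ∀ u, D u = 0 → u = 0) : ∃ C > 0, ∀ u, ‖u‖ ≤ C * ‖D u‖ := by
  by_contra! hc
  have hex : ∀ n : ℕ, ∃ v, ‖v‖ = 1 ∧ ‖D v‖ ≤ 1 / ((n : ℝ) + 1) := by
    intro n
    obtain ⟨u, hu⟩ := hc ((n : ℝ) + 1) (by positivity)
    have hu0 : 0 < ‖u‖ := lt_of_le_of_lt (by positivity) hu
    refine ⟨‖u‖⁻¹ • u, by rw [norm_smul, norm_inv, norm_norm, inv_mul_cancel₀ hu0.ne'], ?_⟩
    rw [map_smul, norm_smul, norm_inv, norm_norm, inv_mul_le_iff₀ hu0, mul_one_div,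
      le_div_iff₀ (by positivity)]
    linarith
  choose v hv hvD using hex
  have hcpt : IsCompact (closure (K '' Metric.closedBall 0 1)) :=
    IsCompactOperator.isCompact_closure_image_closedBall (f := (K : H →ₗ[ℝ] G)) hK 1
  obtain ⟨w, -, φ, hφ, hw⟩ := hcpt.tendsto_subseq (x := fun n => K (v n)) fun n =>
    subset_closure (Set.mem_image_of_mem _ (by simp [hv]))
  have hD0 : Tendsto (fun n => D (v (φ n))) atTop (𝓝 0) := by
    have : Tendsto (fun n => D (v n)) atTop (𝓝 0) :=
      squeeze_zero_norm hvD tendsto_one_div_add_atTop_nhds_zero_nat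
    exact this.comp hφ.tendsto_atTop
  -- The hypothesis makes `(K, D)` a closed embedding, so convergence of the images, obtained from
  -- compactness and `D (v n) → 0`, forces convergence of the unit vectors. Their limit is killed by
  -- `D`, hence zero: a contradiction.
  have hanti : AntilipschitzWith (2 * a.toNNReal) (K.prod D) := by
    refine AddMonoidHomClass.antilipschitz_of_bound _ fun u => ?_
    have h1 : ‖K u‖ ≤ ‖K.prod D u‖ := le_max_left _ _
    have h2 : ‖D u‖ ≤ ‖K.prod D u‖ := le_max_right _ _
    have h3 : a ≤ a.toNNReal := Real.le_coe_toNNReal a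
    refine (h u).trans ?_
    push_cast
    calc a * (‖K u‖ + ‖D u‖) ≤ a.toNNReal * (‖K.prod D u‖ + ‖K.prod D u‖) := by gcongr
      _ = 2 * a.toNNReal * ‖K.prod D u‖ := by ring
  have hemb := hanti.isClosedEmbedding (K.prod D).uniformContinuous
  have hlim : Tendsto (fun n => K.prod D (v (φ n))) atTop (𝓝 (w, 0)) := hw.prodMk_nhds hD0
  obtain ⟨u, hu⟩ := hemb.isClosed_range.mem_of_tendsto hlim
    (Eventually.of_forall fun n => Set.mem_range_self _)
  rw [← hu] at hlim
  have hvu : Tendsto (fun n => v (φ n)) atTop (𝓝 u) := (hemb.tendsto_nhds_iff).2 hlim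
  have hu0 : u = 0 := hD u (congrArg Prod.snd hu)
  have h1 := hvu.norm
  simp only [hv, hu0, norm_zero] at h1
  exact one_ne_zero (tendsto_nhds_unique tendsto_const_nhds h1)

/-! ### Completeness of `H²(Ω)` and `H²_𝒩(Ω)`, and compactness of the lower order terms. -/

variable {N : ℕ} (Ω : BoundedDomain N)

/-- Each test function turns the condition into an equality of two continuous functions of the pair.
-/
theorem isClosed_setOf_isWeakPartial (i : Fin N) :
    IsClosed {p : Ω.L2 × Ω.L2 | Ω.IsWeakPartial i p.1 p.2} := by
  have e : ∀ (f : Ω.L2) {ψ : EuclideanSpace ℝ (Fin N) → ℝ} (hψ : MemLp ψ 2 Ω.vol),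
      ∫ x in Ω.carrier, f x * ψ x = inner ℝ f hψ.toLp := by
    intro f ψ hψ
    rw [inner_eq_integral]
    refine integral_congr_ae ?_
    filter_upwards [hψ.coeFn_toLp] with x hx
    rw [hx]
  simp only [IsWeakPartial, Set.ofPred_forall]
  refine isClosed_iInter fun φ => isClosed_iInter fun h1 => isClosed_iInter fun h2 =>
    isClosed_iInter fun h3 => ?_
  have m1 : MemLp φ 2 Ω.vol := h1.continuous.memLp_of_hasCompactSupport h2
  have m2 : MemLp (fun x => fderiv ℝ φ x (EuclideanSpace.single i 1)) 2 Ω.vol :=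
    (continuous_partial h1 _).memLp_of_hasCompactSupport (hasCompactSupport_partial h2 _)
  simp only [e _ m1, e _ m2]
  exact isClosed_eq (by fun_prop) (by fun_prop)

theorem isClosed_H2 : IsClosed (Ω.H2 : Set Ω.Jet) := by
  have e : (Ω.H2 : Set Ω.Jet) = (⋂ i, (fun U : Ω.Jet => (U (Sum.inl ()), U (Sum.inr (Sum.inl i))))
      ⁻¹' {p | Ω.IsWeakPartial i p.1 p.2}) ∩ ⋂ i, ⋂ j, (fun U : Ω.Jet =>
        (U (Sum.inr (Sum.inl i)), U (Sum.inr (Sum.inr (i, j))))) ⁻¹'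
        {p | Ω.IsWeakPartial j p.1 p.2} := by
    ext U
    simp [H2]
  rw [e]
  exact (isClosed_iInter fun i => (Ω.isClosed_setOf_isWeakPartial i).preimage (by fun_prop)).inter
    (isClosed_iInter fun i => isClosed_iInter fun j =>
      (Ω.isClosed_setOf_isWeakPartial j).preimage (by fun_prop))

instance : CompleteSpace Ω.H2 := Ω.isClosed_H2.completeSpace_coe

theorem isClosed_H2N : IsClosed (Ω.H2N : Set Ω.H2) := by
  have e : (Ω.H2N : Set Ω.H2) = {u | Ω.integL (Ω.incl u) = 0} ∩
      ⋂ i, {u | Ω.integL (Ω.grad i u) = 0} := by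
    ext u
    simp [H2N, integL_apply]
  rw [e]
  exact (isClosed_eq (by fun_prop) continuous_const).inter
    (isClosed_iInter fun i => isClosed_eq (by fun_prop) continuous_const)

instance : CompleteSpace Ω.H2N := Ω.isClosed_H2N.completeSpace_coe

variable {Ω}

theorem isWeakPartial_incl (i : Fin N) (u : Ω.H2) : Ω.IsWeakPartial i (Ω.incl u) (Ω.grad i u) :=
  u.2.1 i

theorem isWeakPartial_grad (i j : Fin N) (u : Ω.H2) :
    Ω.IsWeakPartial j (Ω.grad i u) (Ω.hess i j u) :=
  u.2.2 i j

theorem norm_sq_eq (u : Ω.H2) : ‖u‖ ^ 2 = ‖Ω.incl u‖ ^ 2 + ∑ i, ‖Ω.grad i u‖ ^ 2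
    + ∑ i, ∑ j, ‖Ω.hess i j u‖ ^ 2 := by
  change ‖(u : Ω.Jet)‖ ^ 2 = _
  rw [PiLp.norm_sq_eq_of_L2, Fintype.sum_sum_type, Fintype.sum_sum_type,
    Fintype.sum_prod_type, ← add_assoc]
  simp [incl, grad, hess]

theorem norm_incl_le (u : Ω.H2) : ‖Ω.incl u‖ ≤ ‖u‖ := PiLp.norm_apply_le (u : Ω.Jet) _

theorem norm_grad_le (i : Fin N) (u : Ω.H2) : ‖Ω.grad i u‖ ≤ ‖u‖ :=
  PiLp.norm_apply_le (u : Ω.Jet) _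

theorem norm_hess_le (i j : Fin N) (u : Ω.H2) : ‖Ω.hess i j u‖ ≤ ‖u‖ :=
  PiLp.norm_apply_le (u : Ω.Jet) _

/-- An operator on `H²(Ω)` whose values have weak derivatives controlled by the `H²` norm is
compact as an operator to `L²(Ω)`. -/
theorem IsOfClass.isCompactOperator {k : ℕ} {α : ℝ≥0} (hΩ : Ω.IsOfClass k α) (T : Ω.H2 →L[ℝ] Ω.L2)
    (D : Fin N → Ω.H2 →L[ℝ] Ω.L2) (hT : ∀ u, ‖T u‖ ≤ ‖u‖) (hD : ∀ i u, ‖D i u‖ ≤ ‖u‖)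
    (hTD : ∀ i u, Ω.IsWeakPartial i (T u) (D i u)) : IsCompactOperator T := by
  refine isCompactOperator_of_forall_exists_finset T fun ε hε => ?_
  -- `‖T u‖ + ∑ ‖D i u‖` is at most `(1 + N) ‖u‖`.
  obtain ⟨W, hW⟩ := hΩ.exists_finset_norm_le (ε := ε / (1 + N)) (by positivity)
  refine ⟨W, fun u hu => (hW (T u) (fun i => D i u) (fun i => hTD i u) hu).trans ?_⟩
  rw [div_mul_eq_mul_div, div_le_iff₀ (by positivity), mul_assoc]
  gcongr
  have : ∑ i, ‖D i u‖ ≤ ∑ _i : Fin N, ‖u‖ := Finset.sum_le_sum fun i _ => hD i u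
  simp only [Finset.sum_const, Finset.card_univ, Fintype.card_fin, nsmul_eq_mul] at this
  linarith [hT u]

/-- Rellich's theorem for `H²(Ω)`. -/
theorem IsOfClass.isCompactOperator_incl {k : ℕ} {α : ℝ≥0} (hΩ : Ω.IsOfClass k α) :
    IsCompactOperator Ω.incl :=
  hΩ.isCompactOperator Ω.incl Ω.grad norm_incl_le norm_grad_le isWeakPartial_incl

theorem IsOfClass.isCompactOperator_grad {k : ℕ} {α : ℝ≥0} (hΩ : Ω.IsOfClass k α) (i : Fin N) :
    IsCompactOperator (Ω.grad i) :=
  hΩ.isCompactOperator (Ω.grad i) (Ω.hess i) (norm_grad_le i) (norm_hess_le i)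
    (isWeakPartial_grad i)

theorem ext_incl {u v : Ω.H2} (h : Ω.incl u = Ω.incl v) : u = v := by
  have h1 : ∀ i, Ω.grad i u = Ω.grad i v := fun i =>
    (isWeakPartial_incl i u).unique (h ▸ isWeakPartial_incl i v)
  have h2 : ∀ i j, Ω.hess i j u = Ω.hess i j v := fun i j =>
    (isWeakPartial_grad i j u).unique (h1 i ▸ isWeakPartial_grad i j v)
  refine Subtype.ext (PiLp.ext ?_)
  rintro (_ | i | ⟨i, j⟩)
  exacts [h, h1 i, h2 i j]

/-- Each `∂u/∂x_i` has zero gradient, hence is constant, and its zero mean makes it vanish; the same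
argument then applies to `u`. -/
theorem eq_zero_of_hess_eq_zero {u : Ω.H2} (hu : u ∈ Ω.H2N) (h : ∀ i j, Ω.hess i j u = 0) :
    u = 0 := by
  have hz : ∀ f : Ω.L2, (∫ x in Ω.carrier, f x = 0) → (∀ i, Ω.IsWeakPartial i f 0) → f = 0 := by
    intro f hf hf'
    obtain ⟨c, rfl⟩ := exists_ae_eq_const hf'
    rw [← integL_apply, map_smul, integL_oneL2, smul_eq_mul] at hf
    rw [(mul_eq_zero.1 hf).resolve_right Ω.volR_ne_zero, zero_smul]
  have h1 : ∀ i, Ω.grad i u = 0 := fun i =>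
    hz _ (hu.2 i) fun j => h i j ▸ isWeakPartial_grad i j u
  exact ext_incl (hz _ hu.1 fun i => h1 i ▸ isWeakPartial_incl i u)

/-- A Poincaré type inequality: an injective operator controlling the second derivatives controls
the whole `H²` norm. -/
theorem IsOfClass.exists_norm_le {k : ℕ} {α : ℝ≥0} (hΩ : Ω.IsOfClass k α) {H G : Type*}
    [NormedAddCommGroup H] [NormedSpace ℝ H] [CompleteSpace H] [NormedAddCommGroup G]
    [NormedSpace ℝ G] {ι : H →L[ℝ] Ω.H2} (hι : ∀ u, ‖ι u‖ = ‖u‖) {D : H →L[ℝ] G}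
    (hD : ∀ u, D u = 0 → u = 0) (hess_le : ∀ u i j, ‖Ω.hess i j (ι u)‖ ≤ ‖D u‖) :
    ∃ C > 0, ∀ u, ‖u‖ ≤ C * ‖D u‖ := by
  let K : Ω.H2 →L[ℝ] (Option (Fin N) → Ω.L2) :=
    ContinuousLinearMap.pi fun o => o.elim Ω.incl Ω.grad
  have hK : IsCompactOperator K := isCompactOperator_pi (T := fun o u => K u o) fun o => by
    cases o with
    | none => exact hΩ.isCompactOperator_incl
    | some i => exact hΩ.isCompactOperator_grad i
  -- `K` collects `u` and its gradient and is compact by Rellich; `D` controls the Hessian. The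
  -- constant counts the components of the jet.
  refine exists_norm_le_of_isCompactOperator (K := K ∘L ι) (D := D) (a := 1 + N + N * N)
    (hK.comp_clm ι) (fun u => ?_) hD
  set x := ‖(K ∘L ι) u‖
  set y := ‖D u‖
  have hx : 0 ≤ x := norm_nonneg _
  have hy : 0 ≤ y := norm_nonneg _
  have h0 : ‖Ω.incl (ι u)‖ ≤ x := norm_le_pi_norm (K (ι u)) none
  have h1 : ∀ i, ‖Ω.grad i (ι u)‖ ≤ x := fun i => norm_le_pi_norm (K (ι u)) (some i)
  have s1 : ∑ i, ‖Ω.grad i (ι u)‖ ^ 2 ≤ ∑ _i : Fin N, x ^ 2 :=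
    Finset.sum_le_sum fun i _ => by gcongr; exact h1 i
  have s2 : ∑ i, ∑ j, ‖Ω.hess i j (ι u)‖ ^ 2 ≤ ∑ _i : Fin N, ∑ _j : Fin N, y ^ 2 :=
    Finset.sum_le_sum fun i _ => Finset.sum_le_sum fun j _ => by gcongr; exact hess_le u i j
  simp only [Finset.sum_const, Finset.card_univ, Fintype.card_fin, nsmul_eq_mul] at s1 s2
  refine le_of_sq_le_sq ?_ (by positivity)
  rw [← hι, norm_sq_eq]
  have s0 : ‖Ω.incl (ι u)‖ ^ 2 ≤ x ^ 2 := by gcongr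
  have hN : (0 : ℝ) ≤ N := Nat.cast_nonneg N
  calc _ ≤ x ^ 2 + N * x ^ 2 + N * (N * y ^ 2) := by linarith
    _ ≤ (1 + N + N * N) * (x + y) ^ 2 := by
        nlinarith [mul_nonneg hx hy, mul_nonneg hN (mul_nonneg hx hy),
          mul_nonneg (mul_nonneg hN hN) (mul_nonneg hx hy), mul_nonneg hN (sq_nonneg y),
          mul_nonneg (mul_nonneg hN hN) (sq_nonneg x), sq_nonneg y]
    _ ≤ (1 + N + N * N) ^ 2 * (x + y) ^ 2 := by
        gcongr
        exact le_self_pow₀ (by nlinarith) two_ne_zero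
    _ = _ := by ring

/-- The second derivatives as an operator. -/
def hessPi (Ω : BoundedDomain N) : Ω.H2 →L[ℝ] (Fin N × Fin N → Ω.L2) :=
  ContinuousLinearMap.pi fun p => Ω.hess p.1 p.2

theorem norm_hess_le_hessPi (i j : Fin N) (u : Ω.H2) : ‖Ω.hess i j u‖ ≤ ‖hessPi Ω u‖ :=
  norm_le_pi_norm (hessPi Ω u) (i, j)

theorem hess_eq_zero_of_hessPi {u : Ω.H2} (h : hessPi Ω u = 0) (i j : Fin N) :
    Ω.hess i j u = 0 := congrFun h (i, j)

theorem energyL_eq (σ : ℝ) (u φ : Ω.H2) : Ω.energyL σ u φ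
    = (1 - σ) * (∑ i, ∑ j, inner ℝ (Ω.hess i j u) (Ω.hess i j φ))
      + σ * inner ℝ (Ω.lap u) (Ω.lap φ) := by
  have h : ∀ S : Ω.H2 →L[ℝ] Ω.L2, Ω.pairL S u φ = inner ℝ (S u) (S φ) := fun _ => rfl
  simp [energyL, h]

theorem energyL_symm (σ : ℝ) (u φ : Ω.H2) : Ω.energyL σ u φ = Ω.energyL σ φ u := by
  rw [energyL_eq, energyL_eq, real_inner_comm (Ω.lap φ)]
  congr 2
  exact Finset.sum_congr rfl fun i _ => Finset.sum_congr rfl fun j _ => real_inner_comm _ _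

/-- The Laplacian term is nonnegative because `σ ≥ 0`, and the sum of the squared entries of the
Hessian dominates the maximum norm on `hessPi`. -/
theorem energyL_self_ge {σ : ℝ} (hσ0 : 0 ≤ σ) (hσ1 : σ < 1) (u : Ω.H2) :
    (1 - σ) * ‖hessPi Ω u‖ ^ 2 ≤ Ω.energyL σ u u := by
  rw [energyL_eq]
  have h1 : ‖hessPi Ω u‖ ^ 2 ≤ ∑ i, ∑ j, ‖Ω.hess i j u‖ ^ 2 := by
    have h0 : 0 ≤ ∑ i, ∑ j, ‖Ω.hess i j u‖ ^ 2 := by positivity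
    refine (Real.le_sqrt (norm_nonneg _) h0).1 ((pi_norm_le_iff_of_nonneg (Real.sqrt_nonneg _)).2 ?_)
    rintro ⟨i, j⟩
    refine Real.le_sqrt_of_sq_le ?_
    refine le_trans ?_ (Finset.single_le_sum (f := fun i => ∑ j, ‖Ω.hess i j u‖ ^ 2)
      (fun _ _ => by positivity) (Finset.mem_univ i))
    exact Finset.single_le_sum (f := fun j => ‖Ω.hess i j u‖ ^ 2)
      (fun _ _ => by positivity) (Finset.mem_univ j)
  simp only [real_inner_self_eq_norm_sq]
  have h2 : 0 ≤ σ * ‖Ω.lap u‖ ^ 2 := by positivity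
  nlinarith

/-- The energy is coercive on `H²_𝒩(Ω)`. -/
theorem IsOfClass.exists_le_energyL {k : ℕ} {α : ℝ≥0} (hΩ : Ω.IsOfClass k α) {σ : ℝ}
    (hσ0 : 0 ≤ σ) (hσ1 : σ < 1) :
    ∃ c > 0, ∀ u ∈ Ω.H2N, c * ‖u‖ ^ 2 ≤ Ω.energyL σ u u := by
  obtain ⟨C, hC, h⟩ := @IsOfClass.exists_norm_le N Ω k α hΩ Ω.H2N
    (Fin N × Fin N → Ω.L2) inferInstance inferInstance inferInstance _ _ Ω.H2N.subtypeL
    (fun u => rfl) (hessPi Ω ∘L Ω.H2N.subtypeL)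
    (fun u hu => Subtype.ext (eq_zero_of_hess_eq_zero u.2 (hess_eq_zero_of_hessPi hu)))
    (fun u i j => norm_hess_le_hessPi i j (u : Ω.H2))
  have hσ : 0 < 1 - σ := sub_pos.2 hσ1
  refine ⟨(1 - σ) / C ^ 2, by positivity, fun u hu => le_trans ?_ (energyL_self_ge hσ0 hσ1 u)⟩
  have h1 : ‖u‖ ^ 2 ≤ (C * ‖hessPi Ω u‖) ^ 2 := by gcongr; exact h ⟨u, hu⟩
  rw [div_mul_eq_mul_div, div_le_iff₀ (by positivity)]
  nlinarith

/-- The energy plus the `L²` scalar product is coercive on `H²(Ω)`. -/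
theorem IsOfClass.exists_le_energyL_add {k : ℕ} {α : ℝ≥0} (hΩ : Ω.IsOfClass k α) {σ : ℝ}
    (hσ0 : 0 ≤ σ) (hσ1 : σ < 1) :
    ∃ c > 0, ∀ u, c * ‖u‖ ^ 2 ≤ Ω.energyL σ u u + ‖Ω.incl u‖ ^ 2 := by
  obtain ⟨C, hC, h⟩ := hΩ.exists_norm_le (ι := ContinuousLinearMap.id ℝ Ω.H2) (fun u => rfl)
    (D := Ω.incl.prod (hessPi Ω))
    (fun u hu => ext_incl ((congrArg Prod.fst hu).trans (map_zero Ω.incl).symm))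
    (fun u i j => (norm_hess_le_hessPi i j u).trans (le_max_right _ _))
  have hσ : 0 < 1 - σ := sub_pos.2 hσ1
  refine ⟨min (1 - σ) 1 / C ^ 2, by positivity, fun u => ?_⟩
  have h1 : ‖u‖ ^ 2 ≤ C ^ 2 * (‖hessPi Ω u‖ ^ 2 + ‖Ω.incl u‖ ^ 2) := by
    have h2 : ‖Ω.incl.prod (hessPi Ω) u‖ ^ 2 ≤ ‖hessPi Ω u‖ ^ 2 + ‖Ω.incl u‖ ^ 2 := by
      change max ‖Ω.incl u‖ ‖hessPi Ω u‖ ^ 2 ≤ _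
      rcases max_choice ‖Ω.incl u‖ ‖hessPi Ω u‖ with e | e <;> rw [e] <;>
        nlinarith [sq_nonneg ‖Ω.incl u‖, sq_nonneg ‖hessPi Ω u‖]
    calc ‖u‖ ^ 2 ≤ (C * ‖Ω.incl.prod (hessPi Ω) u‖) ^ 2 := by gcongr; exact h u
      _ = C ^ 2 * ‖Ω.incl.prod (hessPi Ω) u‖ ^ 2 := by ring
      _ ≤ _ := by gcongr
  rw [div_mul_eq_mul_div, div_le_iff₀ (by positivity)]
  set m := min (1 - σ) 1
  have hm : 0 < m := lt_min hσ one_pos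
  calc m * ‖u‖ ^ 2 ≤ m * (C ^ 2 * (‖hessPi Ω u‖ ^ 2 + ‖Ω.incl u‖ ^ 2)) := by gcongr
    _ = (m * ‖hessPi Ω u‖ ^ 2 + m * ‖Ω.incl u‖ ^ 2) * C ^ 2 := by ring
    _ ≤ _ := by
      gcongr
      · refine le_trans ?_ (energyL_self_ge hσ0 hσ1 u)
        gcongr
        exact min_le_left _ _
      · exact mul_le_of_le_one_left (by positivity) (min_le_right _ _)

end

/-! ### The operators `π_𝒩^♯`, `𝒫_σ`, `T_σ` -/

section

variable {N : ℕ} {Ω : BoundedDomain N}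

theorem piNH2_of_mem {u : Ω.H2} (hu : u ∈ Ω.H2N) : Ω.piNH2 u = u := by
  rw [piNH2_apply, hu.1]
  simp [hu.2]

theorem one_mem_calN : Ω.one ∈ Ω.calN := Submodule.subset_span ⟨0, rfl⟩

theorem coord_mem_calN (i : Fin N) : Ω.coord i ∈ Ω.calN := Submodule.subset_span ⟨i.succ, rfl⟩

theorem sub_piNH2_mem_calN (u : Ω.H2) : u - Ω.piNH2 u ∈ Ω.calN := by
  rw [piNH2_apply]
  have h1 := one_mem_calN (Ω := Ω)
  have h2 : ∑ i, (∫ x in Ω.carrier, Ω.grad i u x) • Ω.coord i ∈ Ω.calN :=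
    Submodule.sum_mem _ fun i _ => Submodule.smul_mem _ _ (coord_mem_calN i)
  have e : ∀ a b c : Ω.H2, u - (u - a + b - c) = a - b + c := fun a b c => by abel
  rw [e]
  exact Submodule.add_mem _ (Submodule.sub_mem _ (Submodule.smul_mem _ _ h1)
    (Submodule.smul_mem _ _ h1)) (Submodule.smul_mem _ _ h2)

theorem apply_eq_zero_of_mem_F {G : StrongDual ℝ Ω.H2} (hG : G ∈ Ω.F) {φ : Ω.H2}
    (hφ : φ ∈ Ω.calN) : G φ = 0 := by
  have h : Ω.calN ≤ LinearMap.ker (G : Ω.H2 →ₗ[ℝ] ℝ) := by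
    refine Submodule.span_le.2 ?_
    rintro _ ⟨k, rfl⟩
    refine LinearMap.mem_ker.2 ?_
    refine Fin.cases hG.1 (fun k => hG.2 k) k
  exact LinearMap.mem_ker.1 (h hφ)

/-- Since `φ - π_𝒩 φ` is affine, a functional in `F(Ω)` does not see it. Equations tested on
`H²_𝒩(Ω)` therefore extend to all of `H²(Ω)`. -/
theorem apply_piNH2_of_mem_F {G : StrongDual ℝ Ω.H2} (hG : G ∈ Ω.F) (φ : Ω.H2) :
    G (Ω.piNH2 φ) = G φ := by
  have := apply_eq_zero_of_mem_F hG (sub_piNH2_mem_calN φ)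
  rw [map_sub, sub_eq_zero] at this
  exact this.symm

theorem energyL_calN_right (σ : ℝ) (u : Ω.H2) {φ : Ω.H2} (hφ : φ ∈ Ω.calN) :
    Ω.energyL σ u φ = 0 := apply_eq_zero_of_mem_F (Ω.energyL_mem_F σ u) hφ

theorem energyL_calN_left (σ : ℝ) {u : Ω.H2} (hu : u ∈ Ω.calN) (φ : Ω.H2) :
    Ω.energyL σ u φ = 0 := by rw [energyL_symm, energyL_calN_right σ φ hu]

theorem piSharp_mkQ (u : Ω.H2) : (Ω.piSharp (Ω.calN.mkQ u) : Ω.H2) = Ω.piNH2 u := rfl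

theorem mkQ_piSharp (x : Ω.H2 ⧸ Ω.calN) : Ω.calN.mkQ (Ω.piSharp x : Ω.H2) = x := by
  obtain ⟨u, rfl⟩ := Ω.calN.mkQ_surjective x
  rw [piSharp_mkQ, ← sub_eq_zero, ← map_sub, ← neg_sub, map_neg,
    show Ω.calN.mkQ (u - Ω.piNH2 u) = 0 from
      (Submodule.Quotient.mk_eq_zero _).2 (sub_piNH2_mem_calN u), neg_zero]

theorem piSharp_mkQ_coe (v : Ω.H2N) : Ω.piSharp (Ω.calN.mkQ (v : Ω.H2)) = v :=
  Subtype.ext ((piSharp_mkQ _).trans (piNH2_of_mem v.2))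

/-- The inverse sends `v` to its class: `π_𝒩` fixes `H²_𝒩(Ω)` and changes any `u` only by an affine
function. -/
theorem isInvertible_piSharp : Ω.piSharp.IsInvertible := by
  refine ContinuousLinearMap.IsInvertible.of_inverse (g := Ω.calN.mkQL ∘L Ω.H2N.subtypeL) ?_ ?_
  · ext1 v
    exact piSharp_mkQ_coe v
  · apply ContinuousLinearMap.ext
    intro x
    exact mkQ_piSharp x

theorem norm_le_norm_piSharp (x : Ω.H2 ⧸ Ω.calN) : ‖x‖ ≤ ‖(Ω.piSharp x : Ω.H2)‖ := by
  conv_lhs => rw [← mkQ_piSharp x]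
  exact Submodule.Quotient.norm_mk_le _ _

/-- The Lax–Milgram theorem on a closed subspace. -/
theorem exists_continuousLinearMap_forall_eq {H : Type*} [NormedAddCommGroup H]
    [InnerProductSpace ℝ H] [CompleteSpace H] (B : H →L[ℝ] StrongDual ℝ H) {V : Submodule ℝ H}
    (hV : IsClosed (V : Set H)) {c : ℝ} (hc : 0 < c) (hB : ∀ u ∈ V, c * ‖u‖ ^ 2 ≤ B u u) :
    ∃ R : StrongDual ℝ H →L[ℝ] V, ∀ G : StrongDual ℝ H, ∀ w ∈ V, B (R G) w = G w := by
  have : CompleteSpace V := hV.completeSpace_coe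
  let b : V →L[ℝ] V →L[ℝ] ℝ := B.bilinearComp V.subtypeL V.subtypeL
  have hb : IsCoercive b := ⟨c, hc, fun u => by
    have := hB u u.2
    rw [sq, ← mul_assoc] at this
    exact this⟩
  -- The inverse Riesz map, which is linear because conjugation is trivial over `ℝ`.
  let D : StrongDual ℝ V →L[ℝ] V :=
    { toFun := fun g => (InnerProductSpace.toDual ℝ V).symm g
      map_add' := fun g g' => map_add _ g g'
      map_smul' := fun a g => by simp
      cont := (InnerProductSpace.toDual ℝ V).symm.continuous }
  refine ⟨(hb.continuousLinearEquivOfBilin.symm : V →L[ℝ] V) ∘L D ∘L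
    (ContinuousLinearMap.compL ℝ V H ℝ).flip V.subtypeL, fun G w hw => ?_⟩
  have h1 := hb.continuousLinearEquivOfBilin_apply
    (hb.continuousLinearEquivOfBilin.symm (D (G ∘L V.subtypeL))) ⟨w, hw⟩
  rw [ContinuousLinearEquiv.apply_symm_apply] at h1
  refine h1.symm.trans ?_
  exact InnerProductSpace.toDual_symm_apply

theorem eq_zero_of_coercive {H : Type*} [NormedAddCommGroup H] [InnerProductSpace ℝ H]
    {B : H →L[ℝ] StrongDual ℝ H} {c : ℝ} (hc : 0 < c) {u : H} (hB : c * ‖u‖ ^ 2 ≤ B u u)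
    (h : B u u = 0) : u = 0 := by
  rw [h] at hB
  by_contra hu
  have := norm_pos_iff.2 hu
  exact absurd hB (not_le.2 (by positivity))

theorem exists_apply_self_le {H : Type*} [NormedAddCommGroup H] [InnerProductSpace ℝ H]
    (B : H →L[ℝ] StrongDual ℝ H) : ∃ C, 0 ≤ C ∧ ∀ u, B u u ≤ C * ‖u‖ ^ 2 :=
  ⟨‖B‖, norm_nonneg B, fun u => (le_abs_self _).trans
    ((B.le_opNorm₂ u u).trans_eq (by ring))⟩

/-- Lax–Milgram on `H²_𝒩(Ω)` gives a candidate inverse. It solves the equation for all test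
functions because both functionals lie in `F(Ω)`, and coercivity gives uniqueness. -/
theorem IsOfClass.isInvertible_calP {k : ℕ} {α : ℝ≥0} (hΩ : Ω.IsOfClass k α) {σ : ℝ}
    (hσ0 : 0 ≤ σ) (hσ1 : σ < 1) : (Ω.calP σ).IsInvertible := by
  obtain ⟨c, hc, hco⟩ := hΩ.exists_le_energyL hσ0 hσ1
  obtain ⟨R, hR⟩ := exists_continuousLinearMap_forall_eq (Ω.energyL σ) Ω.isClosed_H2N hc hco
  refine ContinuousLinearMap.IsInvertible.of_inverse (g := R ∘L Ω.F.subtypeL) ?_ ?_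
  · ext1 G
    refine Subtype.ext (ContinuousLinearMap.ext fun φ => ?_)
    change Ω.energyL σ (R G : Ω.H2) φ = (G : StrongDual ℝ Ω.H2) φ
    rw [← apply_piNH2_of_mem_F (Ω.energyL_mem_F σ _), ← apply_piNH2_of_mem_F G.2 φ]
    exact hR _ _ (Ω.piNH2_mem φ)
  · ext1 u
    change R (Ω.energyL σ (u : Ω.H2)) = u
    have hd := (R (Ω.energyL σ (u : Ω.H2)) - u).2
    refine sub_eq_zero.1 (Subtype.ext (eq_zero_of_coercive hc (hco _ hd) ?_))
    have := hR (Ω.energyL σ (u : Ω.H2)) _ hd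
    have e : Ω.energyL σ ((R (Ω.energyL σ (u : Ω.H2)) - u : Ω.H2N) : Ω.H2)
        = Ω.energyL σ (R (Ω.energyL σ (u : Ω.H2)) : Ω.H2) - Ω.energyL σ (u : Ω.H2) :=
      map_sub (Ω.energyL σ) _ _
    rw [e, sub_apply]
    exact sub_eq_zero.2 this

/-- The defining relation of the operator `T σ`. -/
theorem energyL_piSharp_T {σ : ℝ} (h : (Ω.calP σ).IsInvertible) (x : Ω.H2 ⧸ Ω.calN) (φ : Ω.H2) :
    Ω.energyL σ (Ω.piSharp (Ω.T σ x) : Ω.H2) φ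
      = inner ℝ (Ω.Q (Ω.incl (Ω.piSharp x : Ω.H2)) : Ω.L2) (Ω.incl φ) := by
  have e : Ω.calP σ (Ω.piSharp (Ω.T σ x)) = Ω.calJF (Ω.Q (Ω.incl (Ω.piSharp x : Ω.H2))) := by
    change Ω.calP σ (Ω.piSharp (Ω.piSharp.inverse ((Ω.calP σ).inverse _))) = _
    rw [isInvertible_piSharp.self_apply_inverse, h.self_apply_inverse]
    rfl
  exact DFunLike.congr_fun (congrArg Subtype.val e) φ

theorem inner_Q (f g : Ω.L2) : inner ℝ (Ω.Q f : Ω.L2) g = inner ℝ (Ω.Q f) (Ω.Q g) := by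
  rw [Q, Submodule.inner_orthogonalProjectionOnto_eq_of_mem_left]

theorem scalarProd_eq (σ : ℝ) (x y : Ω.H2 ⧸ Ω.calN) :
    Ω.scalarProd σ x y = Ω.energyL σ (Ω.piSharp x : Ω.H2) (Ω.piSharp y : Ω.H2) :=
  (Ω.energyL_apply _ _ _).symm

/-- Symmetry and nonnegativity of `T σ` can be read off the right-hand side. -/
theorem scalarProd_T {σ : ℝ} (h : (Ω.calP σ).IsInvertible) (x y : Ω.H2 ⧸ Ω.calN) :
    Ω.scalarProd σ (Ω.T σ x) y = inner ℝ (Ω.Q (Ω.incl (Ω.piSharp x : Ω.H2)))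
      (Ω.Q (Ω.incl (Ω.piSharp y : Ω.H2))) := by
  rw [scalarProd_eq, energyL_piSharp_T h, inner_Q]

theorem scalarProd_symm (σ : ℝ) (x y : Ω.H2 ⧸ Ω.calN) :
    Ω.scalarProd σ x y = Ω.scalarProd σ y x := by
  rw [scalarProd_eq, scalarProd_eq, energyL_symm]

/-- Below: coercivity, and the quotient norm is at most that of the representative `π_𝒩^♯ x`. Above:
boundedness of the form and of `π_𝒩^♯`. -/
theorem IsOfClass.scalarProd_equivalent {k : ℕ} {α : ℝ≥0} (hΩ : Ω.IsOfClass k α) {σ : ℝ}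
    (hσ0 : 0 ≤ σ) (hσ1 : σ < 1) : ∃ c C : ℝ, 0 < c ∧ ∀ x, c * ‖x‖ ^ 2 ≤ Ω.scalarProd σ x x ∧
      Ω.scalarProd σ x x ≤ C * ‖x‖ ^ 2 := by
  obtain ⟨c, hc, hco⟩ := hΩ.exists_le_energyL hσ0 hσ1
  obtain ⟨C, hC0, hC⟩ := exists_apply_self_le (Ω.energyL σ)
  obtain ⟨M, -, hM⟩ := @ContinuousLinearMap.bound ℝ ℝ (Ω.H2 ⧸ Ω.calN) Ω.H2N inferInstance
    inferInstance _ _ inferInstance inferInstance _ _ Ω.piSharp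
  refine ⟨c, C * M ^ 2, hc, fun x => ?_⟩
  rw [scalarProd_eq]
  constructor
  · refine le_trans ?_ (hco _ (Ω.piSharp x).2)
    gcongr
    exact norm_le_norm_piSharp x
  · refine (hC _).trans ?_
    rw [mul_assoc, ← mul_pow]
    gcongr
    exact hM x

theorem IsOfClass.isCompactOperator_T {k : ℕ} {α : ℝ≥0} (hΩ : Ω.IsOfClass k α) (σ : ℝ) :
    IsCompactOperator (Ω.T σ) := by
  have h1 : IsCompactOperator (Ω.incl ∘L (Ω.H2N.subtypeL ∘L Ω.piSharp)) :=
    hΩ.isCompactOperator_incl.comp_clm _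
  exact h1.clm_comp (Ω.piSharp.inverse ∘L (Ω.calP σ).inverse ∘L Ω.calJF ∘L Ω.Q)

end

/-! ### Eigenvalues of `T_σ` -/

section

variable {N : ℕ} {Ω : BoundedDomain N}

theorem mem_neumannEigenspace_iff {σ lam : ℝ} {u : Ω.H2} : u ∈ Ω.neumannEigenspace σ lam ↔
    ∀ φ : Ω.H2, Ω.energyL σ u φ = lam * inner ℝ (Ω.incl u) (Ω.incl φ) := by
  simp only [energyL_apply, inner_eq_integral]
  rfl

theorem incl_ne_zero {u : Ω.H2} (hu : u ≠ 0) : Ω.incl u ≠ 0 := fun h =>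
  hu (ext_incl (h.trans (map_zero Ω.incl).symm))

theorem energyL_self_nonneg {σ : ℝ} (hσ0 : 0 ≤ σ) (hσ1 : σ < 1) (u : Ω.H2) :
    0 ≤ Ω.energyL σ u u :=
  le_trans (mul_nonneg (sub_nonneg.2 hσ1.le) (sq_nonneg _)) (energyL_self_ge hσ0 hσ1 u)

theorem energyL_self_of_mem {σ lam : ℝ} {u : Ω.H2} (hu : u ∈ Ω.neumannEigenspace σ lam) :
    Ω.energyL σ u u = lam * ‖Ω.incl u‖ ^ 2 := by
  rw [mem_neumannEigenspace_iff.1 hu, real_inner_self_eq_norm_sq]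

theorem IsNeumannEigenvalue.nonneg {σ lam : ℝ} (h : Ω.IsNeumannEigenvalue σ lam) (hσ0 : 0 ≤ σ)
    (hσ1 : σ < 1) : 0 ≤ lam := by
  obtain ⟨u, hu, hu0⟩ := h
  have h1 := energyL_self_nonneg hσ0 hσ1 u
  rw [energyL_self_of_mem hu] at h1
  exact nonneg_of_mul_nonneg_left h1 (pow_pos (norm_pos_iff.2 (incl_ne_zero hu0)) 2)

theorem energyL_piNH2_left (σ : ℝ) (u φ : Ω.H2) : Ω.energyL σ (Ω.piNH2 u) φ = Ω.energyL σ u φ := by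
  rw [energyL_symm, apply_piNH2_of_mem_F (Ω.energyL_mem_F σ φ), energyL_symm]

/-- The energy of `π_𝒩 u` equals that of `u`, so coercivity gives `π_𝒩 u = 0`. -/
theorem IsOfClass.mem_calN_of_energyL_eq_zero {k : ℕ} {α : ℝ≥0} (hΩ : Ω.IsOfClass k α) {σ : ℝ}
    (hσ0 : 0 ≤ σ) (hσ1 : σ < 1) {u : Ω.H2} (hu : Ω.energyL σ u u = 0) : u ∈ Ω.calN := by
  obtain ⟨c, hc, hco⟩ := hΩ.exists_le_energyL hσ0 hσ1
  have h0 : Ω.piNH2 u = 0 := by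
    refine eq_zero_of_coercive hc (hco _ (Ω.piNH2_mem u)) ?_
    rw [energyL_piNH2_left, apply_piNH2_of_mem_F (Ω.energyL_mem_F σ u), hu]
  have := sub_piNH2_mem_calN u
  rwa [h0, sub_zero] at this

theorem IsOfClass.neumannEigenspace_zero {k : ℕ} {α : ℝ≥0} (hΩ : Ω.IsOfClass k α) {σ : ℝ}
    (hσ0 : 0 ≤ σ) (hσ1 : σ < 1) : Ω.neumannEigenspace σ 0 = Ω.calN := by
  ext u
  rw [mem_neumannEigenspace_iff]
  simp only [zero_mul]
  exact ⟨fun h => hΩ.mem_calN_of_energyL_eq_zero hσ0 hσ1 (h u),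
    fun h φ => energyL_calN_left σ h φ⟩

theorem oneL2_ne_zero : Ω.oneL2 ≠ 0 := fun h => Ω.volR_ne_zero (by
  rw [← integL_oneL2, h, map_zero])

theorem linearIndependent_affineBasis (Ω : BoundedDomain N) :
    LinearIndependent ℝ Ω.affineBasis := by
  rw [Fintype.linearIndependent_iff]
  intro c hc
  rw [Fin.sum_univ_succ] at hc
  simp only [affineBasis, Fin.cons_zero, Fin.cons_succ] at hc
  have h1 : ∀ i : Fin N, c i.succ = 0 := by
    intro i
    have h2 := congrArg (Ω.grad i) hc
    simp only [map_add, map_sum, map_smul, grad_one, grad_coord, smul_zero, zero_add, smul_ite,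
      Finset.sum_ite_eq, Finset.mem_univ, if_true, map_zero] at h2
    exact (smul_eq_zero.1 h2).resolve_right oneL2_ne_zero
  simp only [h1, zero_smul, Finset.sum_const_zero, add_zero] at hc
  have h0 := congrArg Ω.incl hc
  rw [map_smul, map_zero, incl_one] at h0
  intro i
  exact Fin.cases ((smul_eq_zero.1 h0).resolve_right oneL2_ne_zero) h1 i

theorem isNeumannEigenvalue_zero (Ω : BoundedDomain N) (σ : ℝ) : Ω.IsNeumannEigenvalue σ 0 := by
  refine ⟨Ω.one, ?_, fun h => ?_⟩
  · rw [mem_neumannEigenspace_iff]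
    intro φ
    rw [zero_mul, energyL_calN_left σ one_mem_calN]
  · exact oneL2_ne_zero (by rw [← incl_one, h, map_zero])

theorem affL2_eq_map (Ω : BoundedDomain N) : Ω.affL2 = Ω.calN.map (Ω.incl : Ω.H2 →ₗ[ℝ] Ω.L2) := by
  rw [affL2, calN, Submodule.map_span, ← Set.range_comp]
  rfl

theorem mem_affL2_orthogonal_iff {f : Ω.L2} :
    f ∈ Ω.affL2ᗮ ↔ ∀ a ∈ Ω.calN, inner ℝ f (Ω.incl a) = 0 := by
  rw [affL2_eq_map, Submodule.mem_orthogonal']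
  simp only [Submodule.mem_map, forall_exists_index, and_imp, forall_apply_eq_imp_iff₂]
  rfl

theorem exists_mem_calN_incl_eq (f : Ω.L2) : ∃ a ∈ Ω.calN, Ω.incl a = f - Ω.Q f := by
  have h : f - Ω.Q f ∈ Ω.calN.map (Ω.incl : Ω.H2 →ₗ[ℝ] Ω.L2) := by
    rw [← affL2_eq_map]
    have := Ω.affL2ᗮ.sub_starProjection_mem_orthogonal f
    rwa [Submodule.orthogonal_orthogonal] at this
  exact h

theorem Q_incl_of_mem_calN {a : Ω.H2} (ha : a ∈ Ω.calN) : Ω.Q (Ω.incl a) = 0 := by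
  have h : Ω.incl a ∈ Ω.affL2 := by
    rw [affL2_eq_map]
    exact ⟨a, ha, rfl⟩
  exact Submodule.orthogonalProjectionOnto_eq_zero_iff.2 (Ω.affL2.le_orthogonal_orthogonal h)

theorem Q_of_mem {f : Ω.L2} (hf : f ∈ Ω.affL2ᗮ) : (Ω.Q f : Ω.L2) = f :=
  Submodule.starProjection_eq_self_iff.2 hf

/-- An eigenvalue of `T σ` is the reciprocal of a positive Neumann eigenvalue. -/
theorem IsOfClass.exists_neumannEigenvalue {k : ℕ} {α : ℝ≥0} (hΩ : Ω.IsOfClass k α) {σ : ℝ}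
    (hσ0 : 0 ≤ σ) (hσ1 : σ < 1) {μ : ℝ} {x : Ω.H2 ⧸ Ω.calN} (hx : x ≠ 0)
    (hT : Ω.T σ x = μ • x) : 0 < μ ∧ Ω.IsNeumannEigenvalue σ μ⁻¹ := by
  set v : Ω.H2 := (Ω.piSharp x).1
  have hvx : Ω.calN.mkQ v = x := mkQ_piSharp x
  -- The representative `v` has mean conditions on its gradient, whereas a Neumann eigenfunction
  -- must be `L²`-orthogonal to affine functions. Subtracting the affine `L²` component `a` repairs
  -- this without changing the energy.
  obtain ⟨a, ha, hav⟩ := exists_mem_calN_incl_eq (Ω.incl v)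
  set u := v - a
  have hu : Ω.incl u = Ω.Q (Ω.incl v) := by rw [map_sub, hav]; abel
  have hEu : ∀ φ, Ω.energyL σ u φ = Ω.energyL σ v φ := by
    intro φ
    rw [energyL_symm, map_sub, energyL_calN_right σ φ ha, sub_zero, energyL_symm]
  have hrel : ∀ φ, μ * Ω.energyL σ u φ = inner ℝ (Ω.incl u) (Ω.incl φ) := by
    intro φ
    have h1 := energyL_piSharp_T (hΩ.isInvertible_calP hσ0 hσ1) x φ
    have h2 : (Ω.piSharp (μ • x) : Ω.H2) = μ • v := by rw [map_smul]; rfl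
    rw [hT, h2, energyL_symm, map_smul, smul_eq_mul, energyL_symm] at h1
    rw [hu, hEu]
    exact h1
  have hu0 : u ≠ 0 := by
    intro h
    have hva : v = a := sub_eq_zero.1 h
    apply hx
    rw [← hvx, hva]
    exact (Submodule.Quotient.mk_eq_zero _).2 ha
  have hself := hrel u
  rw [real_inner_self_eq_norm_sq] at hself
  have hpos : 0 < μ * Ω.energyL σ u u := by
    rw [hself]; exact pow_pos (norm_pos_iff.2 (incl_ne_zero hu0)) 2
  have hμ : 0 < μ := (pos_iff_pos_of_mul_pos hpos).2
    ((energyL_self_nonneg hσ0 hσ1 u).lt_of_ne' (right_ne_zero_of_mul hpos.ne'))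
  refine ⟨hμ, u, mem_neumannEigenspace_iff.2 fun φ => ?_, hu0⟩
  rw [← hrel φ, inv_mul_cancel_left₀ hμ.ne']

/-- A positive Neumann eigenvalue is the reciprocal of an eigenvalue of `T σ`. -/
theorem IsOfClass.exists_T_eq {k : ℕ} {α : ℝ≥0} (hΩ : Ω.IsOfClass k α) {σ : ℝ}
    (hσ0 : 0 ≤ σ) (hσ1 : σ < 1) {lam : ℝ} (hlam : 0 < lam) (h : Ω.IsNeumannEigenvalue σ lam) :
    ∃ x : Ω.H2 ⧸ Ω.calN, x ≠ 0 ∧ Ω.T σ x = lam⁻¹ • x := by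
  obtain ⟨c, hc, hco⟩ := hΩ.exists_le_energyL hσ0 hσ1
  obtain ⟨u, hu, hu0⟩ := h
  have hself := energyL_self_of_mem hu
  rw [mem_neumannEigenspace_iff] at hu
  refine ⟨Ω.calN.mkQ u, fun h0 => ?_, ?_⟩
  · have hun : u ∈ Ω.calN := (Submodule.Quotient.mk_eq_zero _).1 h0
    rw [energyL_calN_left σ hun] at hself
    have : 0 < lam * ‖Ω.incl u‖ ^ 2 :=
      mul_pos hlam (pow_pos (norm_pos_iff.2 (incl_ne_zero hu0)) 2)
    exact this.ne hself
  -- Testing with affine functions kills the energy side, and `lam ≠ 0`.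
  · have horth : Ω.incl u ∈ Ω.affL2ᗮ := by
      rw [mem_affL2_orthogonal_iff]
      intro a ha
      have h1 := hu a
      rw [energyL_calN_right σ u ha] at h1
      exact (mul_eq_zero.1 h1.symm).resolve_left hlam.ne'
    have hQ : (Ω.Q (Ω.incl (Ω.piNH2 u)) : Ω.L2) = Ω.incl u := by
      have h1 := Q_incl_of_mem_calN (sub_piNH2_mem_calN u)
      rw [map_sub, map_sub, sub_eq_zero] at h1
      rw [← h1, Q_of_mem horth]
    set w : Ω.H2 := (Ω.piSharp (Ω.T σ (Ω.calN.mkQ u))).1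
    have hw : ∀ φ, Ω.energyL σ w φ = lam⁻¹ * Ω.energyL σ (Ω.piNH2 u) φ := by
      intro φ
      have h1 := energyL_piSharp_T (hΩ.isInvertible_calP hσ0 hσ1) (Ω.calN.mkQ u) φ
      rw [piSharp_mkQ, hQ] at h1
      rw [energyL_piNH2_left, hu φ, inv_mul_cancel_left₀ hlam.ne']
      exact h1
    -- Both vectors lie in `H²_𝒩(Ω)` and have the same energy pairings, so coercivity identifies
    -- them.
    have hd : w - lam⁻¹ • Ω.piNH2 u = 0 := by
      refine eq_zero_of_coercive hc (hco _ (Ω.H2N.sub_mem (Submodule.coe_mem _)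
        (Ω.H2N.smul_mem _ (Ω.piNH2_mem u)))) ?_
      rw [energyL_symm, map_sub, map_smul, energyL_symm, hw, energyL_symm σ _ (Ω.piNH2 u),
        smul_eq_mul, sub_self]
    calc Ω.T σ (Ω.calN.mkQ u) = Ω.calN.mkQ w := (mkQ_piSharp _).symm
      _ = lam⁻¹ • Ω.calN.mkQ (Ω.piNH2 u) := by rw [sub_eq_zero.1 hd, map_smul]
      _ = lam⁻¹ • Ω.calN.mkQ u := by rw [← piSharp_mkQ, mkQ_piSharp]

theorem IsOfClass.setOf_hasEigenvalue_T {k : ℕ} {α : ℝ≥0} (hΩ : Ω.IsOfClass k α) {σ : ℝ}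
    (hσ0 : 0 ≤ σ) (hσ1 : σ < 1) :
    {μ : ℝ | Module.End.HasEigenvalue (Ω.T σ : (Ω.H2 ⧸ Ω.calN) →ₗ[ℝ] (Ω.H2 ⧸ Ω.calN)) μ} =
      {μ : ℝ | ∃ lam : ℝ, 0 < lam ∧ Ω.IsNeumannEigenvalue σ lam ∧ μ = lam⁻¹} := by
  ext μ
  constructor
  · intro h
    obtain ⟨x, hx, hx0⟩ := Module.End.HasEigenvalue.exists_hasEigenvector h
    obtain ⟨h1, h2⟩ := hΩ.exists_neumannEigenvalue hσ0 hσ1 hx0 (Module.End.mem_eigenspace_iff.1 hx)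
    exact ⟨μ⁻¹, inv_pos.2 h1, h2, (inv_inv μ).symm⟩
  · rintro ⟨lam, hlam, h, rfl⟩
    obtain ⟨x, hx0, hx⟩ := hΩ.exists_T_eq hσ0 hσ1 hlam h
    exact Module.End.hasEigenvalue_of_hasEigenvector ⟨Module.End.mem_eigenspace_iff.2 hx, hx0⟩

end

/-! ### Auxiliary facts on the spectrum -/

section

/-- An infinite set of reals with finite intersections with all half-lines `(-∞, M]` is the range
of a strictly increasing sequence tending to infinity. -/
theorem exists_strictMono_range_eq {S : Set ℝ} (hS : S.Infinite)
    (hfin : ∀ M, (S ∩ Set.Iic M).Finite) :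
    ∃ ν : ℕ → ℝ, StrictMono ν ∧ Tendsto ν atTop atTop ∧ Set.range ν = S := by
  classical
  have hgt : ∀ M, ∃ s ∈ S, M < s := by
    intro M
    by_contra! hc
    exact hS ((hfin M).subset fun s hs => ⟨hs, hc s hs⟩)
  obtain ⟨s₀, hs₀⟩ := hS.nonempty
  obtain ⟨m, hm, hmin⟩ := Set.exists_min_image _ id (hfin s₀) ⟨s₀, hs₀, Set.mem_Iic.2 le_rfl⟩
  have hbot : ∀ s : S, (⟨m, hm.1⟩ : S) ≤ s := by
    intro s
    rcases le_total (s : ℝ) s₀ with h | h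
    · exact hmin s ⟨s.2, h⟩
    · exact show m ≤ (s : ℝ) from le_trans (Set.mem_Iic.1 hm.2) h
  -- A locally finite linear order with a least element and no greatest one is isomorphic to `ℕ`.
  let _ : OrderBot S := { bot := ⟨m, hm.1⟩, bot_le := hbot }
  have : NoMaxOrder S := ⟨fun a => by
    obtain ⟨s, hs, h⟩ := hgt a
    exact ⟨⟨s, hs⟩, h⟩⟩
  let _ : LocallyFiniteOrder S := LocallyFiniteOrder.ofFiniteIcc fun a b => by
    refine Set.Finite.of_finite_image (f := Subtype.val) ((hfin b).subset ?_)
      Subtype.val_injective.injOn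
    rintro _ ⟨s, hs, rfl⟩
    exact ⟨s.2, hs.2⟩
  let _ : SuccOrder S := LinearLocallyFiniteOrder.succOrder S
  let _ : PredOrder S := LinearLocallyFiniteOrder.predOrder S
  let e : S ≃o ℕ := orderIsoNatOfLinearSuccPredArch
  have hmono : StrictMono fun n => (e.symm n : ℝ) := fun a b hab => e.symm.strictMono hab
  refine ⟨fun n => e.symm n, hmono, ?_, ?_⟩
  · refine tendsto_atTop_atTop_of_monotone hmono.monotone fun M => ?_
    obtain ⟨s, hs, h⟩ := hgt M
    exact ⟨e ⟨s, hs⟩, by simpa using h.le⟩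
  · ext s
    constructor
    · rintro ⟨n, rfl⟩
      exact (e.symm n).2
    · intro hs
      exact ⟨e ⟨s, hs⟩, by simp⟩

variable {N : ℕ} {Ω : BoundedDomain N}

/-- For `N ≥ 1` the domain contains infinitely many disjoint nonempty open sets; their indicators
are nonzero and orthogonal. -/
theorem not_finiteDimensional_L2 (hN : 1 ≤ N) (Ω : BoundedDomain N) :
    ¬ FiniteDimensional ℝ Ω.L2 := by
  intro hfd
  have : Nonempty (Fin N) := ⟨⟨0, hN⟩⟩
  obtain ⟨x₀, hx₀⟩ := Ω.isConnected.nonempty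
  have hinf : Infinite Ω.carrier :=
    (infinite_of_mem_nhds x₀ (Ω.isOpen.mem_nhds hx₀)).to_subtype
  obtain ⟨U, hU1, hU2, hU3⟩ := exists_seq_infinite_isOpen_pairwise_disjoint Ω.carrier
  let V : ℕ → Set (EuclideanSpace ℝ (Fin N)) := fun n => Subtype.val '' U n
  have hVo : ∀ n, IsOpen (V n) := fun n => Ω.isOpen.isOpenMap_subtype_val _ (hU2 n)
  have hVd : Pairwise (Function.onFun Disjoint V) := fun i j hij =>
    Set.disjoint_image_of_injective Subtype.val_injective (hU3 hij)
  have hVΩ : ∀ n, V n ⊆ Ω.carrier := by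
    rintro n _ ⟨x, -, rfl⟩
    exact x.2
  have hVm : ∀ n, Ω.vol (V n) ≠ 0 := by
    intro n
    rw [Measure.restrict_eq_self _ (hVΩ n)]
    exact ((hVo n).measure_pos _ ((hU1 n).nonempty.image _)).ne'
  let f : ℕ → Ω.L2 := fun n =>
    indicatorConstLp 2 (hVo n).measurableSet (measure_ne_top _ _) (1 : ℝ)
  have hf0 : ∀ n, f n ≠ 0 := by
    intro n h
    have h1 := congrArg norm h
    rw [norm_indicatorConstLp (by norm_num) (by norm_num), norm_zero, norm_one, one_mul] at h1
    have h2 : 0 < Ω.vol.real (V n) := ENNReal.toReal_pos (hVm n) (measure_ne_top _ _)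
    exact (Real.rpow_pos_of_pos h2 _).ne' h1
  have horth : Pairwise fun i j => inner ℝ (f i) (f j) = 0 := by
    intro i j hij
    rw [L2.inner_indicatorConstLp_one]
    rw [setIntegral_congr_ae (g := fun _ => (0 : ℝ)) (hVo i).measurableSet, integral_zero]
    filter_upwards [indicatorConstLp_coeFn (p := 2) (hs := (hVo j).measurableSet)
      (hμs := measure_ne_top Ω.vol _) (c := (1 : ℝ))] with x hx hxi
    rw [hx, Set.indicator_of_notMem (Set.disjoint_left.1 (hVd hij) hxi)]
  have hli : LinearIndependent ℝ f := linearIndependent_of_ne_zero_of_inner_eq_zero hf0 horth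
  have := hli.finite
  exact not_finite ℕ

/-- Test functions as elements of `H²(Ω)`. -/
theorem exists_incl_eq_toLp {φ : EuclideanSpace ℝ (Fin N) → ℝ} (h1 : ContDiff ℝ ∞ φ)
    (h2 : HasCompactSupport φ) : ∃ u : Ω.H2, Ω.incl u =ᵐ[Ω.vol] φ := by
  have c1 : ∀ i, ContDiff ℝ ∞ fun x => fderiv ℝ φ x (EuclideanSpace.single i 1) := fun i =>
    (h1.fderiv_right (m := ∞) (by simp)).clm_apply contDiff_const
  have s1 : ∀ i, HasCompactSupport fun x => fderiv ℝ φ x (EuclideanSpace.single i (1 : ℝ)) :=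
    fun i => hasCompactSupport_partial h2 _
  have m0 : MemLp φ 2 Ω.vol := h1.continuous.memLp_of_hasCompactSupport h2
  have m1 : ∀ i, MemLp (fun x => fderiv ℝ φ x (EuclideanSpace.single i 1)) 2 Ω.vol := fun i =>
    (c1 i).continuous.memLp_of_hasCompactSupport (s1 i)
  have m2 : ∀ i j, MemLp (fun x => fderiv ℝ (fun x => fderiv ℝ φ x (EuclideanSpace.single i 1)) x
      (EuclideanSpace.single j 1)) 2 Ω.vol := fun i j =>
    (continuous_partial (c1 i) _).memLp_of_hasCompactSupport (hasCompactSupport_partial (s1 i) _)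
  exact ⟨⟨WithLp.toLp 2 (Sum.elim (fun _ => m0.toLp)
      (Sum.elim (fun i => (m1 i).toLp) fun p => (m2 p.1 p.2).toLp)),
    fun i => isWeakPartial_of_contDiff h1 m0.coeFn_toLp (m1 i).coeFn_toLp,
    fun i j => isWeakPartial_of_contDiff (c1 i) (m1 i).coeFn_toLp (m2 i j).coeFn_toLp⟩,
    m0.coeFn_toLp⟩

/-- `H²(Ω)` is dense in `L²(Ω)`. -/
theorem eq_zero_of_forall_inner_incl {f : Ω.L2} (hf : ∀ u, inner ℝ f (Ω.incl u) = 0) : f = 0 := by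
  have h0 : eLpNorm f 2 (volume.restrict Ω.carrier) ≤ ENNReal.ofReal 0 := by
    refine eLpNorm_le_of_abs_integral_test_le Ω.isOpen (Lp.memLp f) le_rfl ?_
    intro φ h1 h2 h3
    obtain ⟨u, hu⟩ := exists_incl_eq_toLp (Ω := Ω) h1 h2
    have := hf u
    rw [inner_eq_integral] at this
    rw [zero_mul, ← this]
    refine le_of_eq ?_
    rw [this, abs_eq_zero, ← this]
    refine integral_congr_ae ?_
    filter_upwards [hu] with x hx
    rw [hx]
  rw [ENNReal.ofReal_zero, nonpos_iff_eq_zero] at h0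
  rw [← norm_eq_zero, Lp.norm_def, h0, ENNReal.toReal_zero]

end

/-! ### Weak eigenvalue problems with compact embedding -/

section

section Abstract

variable {H L : Type*} [NormedAddCommGroup H] [InnerProductSpace ℝ H]
  [NormedAddCommGroup L] [InnerProductSpace ℝ L]
  {B : H →L[ℝ] StrongDual ℝ H} {j : H →L[ℝ] L} {E : ℝ → Submodule ℝ H} {c : ℝ}

/-- The solution operator of `B u φ + ⟪j u, j φ⟫ = ⟪f, j φ⟫`. -/
theorem exists_resolvent [CompleteSpace H] (hc : 0 < c) (hco : ∀ u, c * ‖u‖ ^ 2 ≤ B u u + ‖j u‖ ^ 2) :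
    ∃ S : L →L[ℝ] H, ∀ f φ, B (S f) φ + inner ℝ (j (S f)) (j φ) = inner ℝ f (j φ) := by
  let I := (isBoundedBilinearMap_inner (𝕜 := ℝ) (E := L)).toContinuousLinearMap
  let B' : H →L[ℝ] StrongDual ℝ H := B + I.bilinearComp j j
  have hB' : ∀ u φ, B' u φ = B u φ + inner ℝ (j u) (j φ) := fun u φ => rfl
  obtain ⟨R, hR⟩ := exists_continuousLinearMap_forall_eq B' (V := ⊤) isClosed_univ hc
    (fun u _ => by rw [hB', real_inner_self_eq_norm_sq]; exact hco u)
  refine ⟨(⊤ : Submodule ℝ H).subtypeL ∘L R ∘L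
    I.bilinearComp (ContinuousLinearMap.id ℝ L) j, fun f φ => ?_⟩
  exact hR (I.bilinearComp (ContinuousLinearMap.id ℝ L) j f) φ trivial

/-- Both sides are the symmetric form `B + ⟪j ·, j ·⟫` evaluated at `S f` and `S g`. -/
theorem isSymmetric_resolvent (hB : ∀ u φ, B u φ = B φ u) {S : L →L[ℝ] H}
    (hS : ∀ f φ, B (S f) φ + inner ℝ (j (S f)) (j φ) = inner ℝ f (j φ)) :
    ((j ∘L S : L →L[ℝ] L) : L →ₗ[ℝ] L).IsSymmetric := by
  intro f g
  change inner ℝ (j (S f)) g = inner ℝ f (j (S g))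
  rw [← hS f, hB, real_inner_comm g, ← hS g, real_inner_comm (j (S f))]


/-- Each eigenvector of the resolvent is the image of an eigenvector of the form. -/
theorem exists_eigenvector_of_resolvent
    (hE : ∀ lam u, u ∈ E lam ↔ ∀ φ, B u φ = lam * inner ℝ (j u) (j φ))
    (hd : ∀ f : L, (∀ u, inner ℝ f (j u) = 0) → f = 0) {S : L →L[ℝ] H}
    (hS : ∀ f φ, B (S f) φ + inner ℝ (j (S f)) (j φ) = inner ℝ f (j φ))
    (hj : Function.Injective j) {μ : ℝ} {f : L} (hf : j (S f) = μ • f) :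
    ∃ lam, ∃ u ∈ E lam, j u = f := by
  by_cases hμ : μ = 0
  -- For `μ = 0`, `f` is orthogonal to the dense range of `j`, so `f = 0` and the zero vector
  -- serves.
  · have h0 : S f = 0 := hj (by rw [hf, hμ, zero_smul, map_zero])
    refine ⟨0, 0, zero_mem _, ?_⟩
    rw [map_zero]
    refine (hd f fun u => ?_).symm
    rw [← hS f u, h0, map_zero, map_zero, inner_zero_left, add_zero]
    rfl
  · have hju : j (μ⁻¹ • S f) = f := by rw [map_smul, hf, inv_smul_smul₀ hμ]
    -- The added `L²` scalar product shifts the eigenvalues of the form by one.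
    refine ⟨μ⁻¹ - 1, μ⁻¹ • S f, (hE _ _).2 fun φ => ?_, hju⟩
    have h1 := hS f φ
    rw [hf, real_inner_smul_left] at h1
    rw [hju, map_smul, smul_apply, smul_eq_mul, eq_sub_of_add_eq h1]
    field_simp

/-- `(lam + 1)⁻¹ • u` solves the shifted problem with datum `j u`, and coercivity makes the solution
unique. -/
theorem mem_eigenspace_resolvent
    (hE : ∀ lam u, u ∈ E lam ↔ ∀ φ, B u φ = lam * inner ℝ (j u) (j φ))
    (hc : 0 < c) (hco : ∀ u, c * ‖u‖ ^ 2 ≤ B u u + ‖j u‖ ^ 2) {S : L →L[ℝ] H}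
    (hS : ∀ f φ, B (S f) φ + inner ℝ (j (S f)) (j φ) = inner ℝ f (j φ))
    {lam : ℝ} (hlam : lam + 1 ≠ 0) {u : H} (hu : u ∈ E lam) :
    j (S (j u)) = (lam + 1)⁻¹ • j u := by
  have hz : S (j u) - (lam + 1)⁻¹ • u = 0 := by
    set z := S (j u) - (lam + 1)⁻¹ • u
    have h1 := hS (j u) z
    have h2 := (hE _ _).1 hu z
    have h3 : B z z + ‖j z‖ ^ 2 = 0 := by
      have e1 : B z z = B (S (j u)) z - (lam + 1)⁻¹ * B u z := by
        conv_lhs => rw [show B z = B (S (j u)) - (lam + 1)⁻¹ • B u by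
          rw [← map_smul, ← map_sub]]
        rfl
      have e2 : ‖j z‖ ^ 2 = inner ℝ (j (S (j u))) (j z) - (lam + 1)⁻¹ * inner ℝ (j u) (j z) := by
        rw [← real_inner_self_eq_norm_sq, ← real_inner_smul_left, ← inner_sub_left, ← map_smul,
          ← map_sub]
      rw [e1, e2, h2]
      have : (lam + 1)⁻¹ * (lam * inner ℝ (j u) (j z)) + (lam + 1)⁻¹ * inner ℝ (j u) (j z)
          = inner ℝ (j u) (j z) := by field_simp
      linarith
    have h4 := hco z
    rw [h3] at h4
    by_contra hne
    have := norm_pos_iff.2 hne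
    exact absurd h4 (not_le.2 (by positivity))
  rw [sub_eq_zero.1 hz, map_smul]

theorem nonneg_of_mem (hE : ∀ lam u, u ∈ E lam ↔ ∀ φ, B u φ = lam * inner ℝ (j u) (j φ))
    (hj : Function.Injective j) (hB0 : ∀ u, 0 ≤ B u u) {lam : ℝ} {u : H} (hu : u ∈ E lam)
    (hu0 : u ≠ 0) : 0 ≤ lam := by
  have h1 := hB0 u
  rw [(hE _ _).1 hu, real_inner_self_eq_norm_sq] at h1
  refine nonneg_of_mul_nonneg_left h1 (pow_pos (norm_pos_iff.2 fun h => hu0 ?_) 2)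
  exact hj (h.trans (map_zero j).symm)

/-- For `lam < 0` the space is trivial. Otherwise `j` embeds it into the eigenspace of a compact
operator for the nonzero eigenvalue `(lam + 1)⁻¹`. -/
theorem finiteDimensional_eigenspace [CompleteSpace H] [CompleteSpace L]
    (hE : ∀ lam u, u ∈ E lam ↔ ∀ φ, B u φ = lam * inner ℝ (j u) (j φ))
    (hB0 : ∀ u, 0 ≤ B u u)
    (hc : 0 < c) (hco : ∀ u, c * ‖u‖ ^ 2 ≤ B u u + ‖j u‖ ^ 2)
    (hj : Function.Injective j) (hjc : IsCompactOperator j) (lam : ℝ) :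
    FiniteDimensional ℝ (E lam) := by
  rcases lt_or_ge lam 0 with hlam | hlam
  · have : E lam = ⊥ := by
      rw [Submodule.eq_bot_iff]
      intro u hu
      by_contra hu0
      exact absurd (nonneg_of_mem hE hj hB0 hu hu0) (not_le.2 hlam)
    rw [this]
    infer_instance
  · have hlam1 : lam + 1 ≠ 0 := by positivity
    obtain ⟨S, hS⟩ := exists_resolvent hc hco
    have hcomp : IsCompactOperator (j ∘L S : L →L[ℝ] L) := hjc.comp_clm S
    have hfd := ContinuousLinearMap.finite_dimensional_eigenspace hcomp _ (inv_ne_zero hlam1)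
    let g : E lam →ₗ[ℝ] Module.End.eigenspace ((j ∘L S : L →L[ℝ] L) : L →ₗ[ℝ] L) (lam + 1)⁻¹ :=
      ((j : H →ₗ[ℝ] L) ∘ₗ (E lam).subtype).codRestrict _ fun u =>
        Module.End.mem_eigenspace_iff.2 (mem_eigenspace_resolvent hE hc hco hS hlam1 u.2)
    refine FiniteDimensional.of_injective g fun u v huv => ?_
    exact Subtype.ext (hj (congrArg Subtype.val huv))

/-- By the spectral theorem the images of the eigenspaces span a dense subspace of `L`. Finitely
many finite-dimensional ones would span a closed, hence full, finite-dimensional space. -/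
theorem infinite_setOf_eigenvalue [CompleteSpace H] [CompleteSpace L]
    (hE : ∀ lam u, u ∈ E lam ↔ ∀ φ, B u φ = lam * inner ℝ (j u) (j φ))
    (hB : ∀ u φ, B u φ = B φ u) (hB0 : ∀ u, 0 ≤ B u u)
    (hc : 0 < c) (hco : ∀ u, c * ‖u‖ ^ 2 ≤ B u u + ‖j u‖ ^ 2)
    (hj : Function.Injective j) (hjc : IsCompactOperator j)
    (hd : ∀ f : L, (∀ u, inner ℝ f (j u) = 0) → f = 0) (hL : ¬ FiniteDimensional ℝ L) :
    {lam | ∃ u ∈ E lam, u ≠ 0}.Infinite := by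
  intro hfin
  have := hfin.to_subtype
  have := fun lam => finiteDimensional_eigenspace hE hB0 hc hco hj hjc lam
  obtain ⟨S, hS⟩ := exists_resolvent hc hco
  have hcomp : IsCompactOperator (j ∘L S : L →L[ℝ] L) := hjc.comp_clm S
  let W : Submodule ℝ L := (⨆ lam : {lam | ∃ u ∈ E lam, u ≠ 0}, E lam).map (j : H →ₗ[ℝ] L)
  have hW : W = ⊤ := by
    rw [← Submodule.orthogonal_eq_bot_iff, ← le_bot_iff,
      ← ContinuousLinearMap.orthogonalComplement_iSup_eigenspaces_eq_bot hcomp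
        (isSymmetric_resolvent hB hS)]
    refine Submodule.orthogonal_le (iSup_le fun μ f hf => ?_)
    obtain ⟨lam, u, hu, rfl⟩ :=
      exists_eigenvector_of_resolvent hE hd hS hj (Module.End.mem_eigenspace_iff.1 hf)
    refine Submodule.mem_map_of_mem ?_
    by_cases hu0 : u = 0
    · rw [hu0]
      exact zero_mem _
    · exact Submodule.mem_iSup_of_mem (p := fun l : {lam | ∃ u ∈ E lam, u ≠ 0} => E l)
        ⟨lam, u, hu, hu0⟩ hu
  refine hL (Module.finite_def.2 ?_)
  rw [← hW]
  exact (Submodule.fg_iff_finiteDimensional _).2 inferInstance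

/-- Infinitely many eigenvalues below `M` would give eigenvectors bounded in `H` by coercivity, with
orthonormal images in `L`. These are at mutual distance `√2`, against compactness of `j`. -/
theorem finite_setOf_eigenvalue_le
    (hE : ∀ lam u, u ∈ E lam ↔ ∀ φ, B u φ = lam * inner ℝ (j u) (j φ))
    (hB : ∀ u φ, B u φ = B φ u)
    (hc : 0 < c) (hco : ∀ u, c * ‖u‖ ^ 2 ≤ B u u + ‖j u‖ ^ 2)
    (hj : Function.Injective j) (hjc : IsCompactOperator j) (M : ℝ) :
    ({lam | ∃ u ∈ E lam, u ≠ 0} ∩ Set.Iic M).Finite := by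
  by_contra hinf
  let ι := Set.Infinite.natEmbedding _ hinf
  have hex : ∀ n, ∃ u ∈ E (ι n : ℝ), ‖j u‖ = 1 := by
    intro n
    obtain ⟨u, hu, hu0⟩ := (ι n).2.1
    have hju : ‖j u‖ ≠ 0 := norm_ne_zero_iff.2 fun h => hu0 (hj (h.trans (map_zero j).symm))
    refine ⟨‖j u‖⁻¹ • u, Submodule.smul_mem _ _ hu, ?_⟩
    rw [map_smul, norm_smul, norm_inv, norm_norm, inv_mul_cancel₀ hju]
  choose u hu hu1 using hex
  have horth : ∀ m n, m ≠ n → inner ℝ (j (u m)) (j (u n)) = 0 := by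
    intro m n hmn
    have h1 := (hE _ _).1 (hu m) (u n)
    rw [hB, (hE _ _).1 (hu n), real_inner_comm] at h1
    have hne : (ι n : ℝ) ≠ ι m := fun h => hmn (ι.injective (Subtype.ext h)).symm
    by_contra h0
    exact hne (mul_right_cancel₀ h0 h1)
  have hbd : ∀ n, u n ∈ Metric.closedBall (0 : H) (Real.sqrt ((M + 1) / c)) := by
    intro n
    have h1 := hco (u n)
    rw [(hE _ _).1 (hu n), real_inner_self_eq_norm_sq, hu1] at h1
    have h2 : (ι n : ℝ) ≤ M := (ι n).2.2
    rw [mem_closedBall_zero_iff]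
    refine Real.le_sqrt_of_sq_le ((le_div_iff₀ hc).2 ?_)
    linarith
  obtain ⟨f, -, φ, hφ, hlim⟩ := (hjc.isCompact_closure_image_closedBall _).tendsto_subseq
    fun n => subset_closure (Set.mem_image_of_mem j (hbd n))
  obtain ⟨K, hK⟩ := Metric.cauchySeq_iff'.1 hlim.cauchySeq 1 one_pos
  have h1 := hK (K + 1) K.le_succ
  rw [dist_eq_norm] at h1
  have h2 : ‖j (u (φ (K + 1))) - j (u (φ K))‖ ^ 2 = 2 := by
    rw [norm_sub_sq_real, horth _ _ (hφ.injective.ne K.succ_ne_self), hu1, hu1]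
    norm_num
  have h3 : ‖j (u (φ (K + 1))) - j (u (φ K))‖ ^ 2 < 1 :=
    pow_lt_one₀ (norm_nonneg _) h1 two_ne_zero
  linarith

end Abstract

end

/-! ### The Neumann eigenvalues -/

section

variable {N : ℕ} {Ω : BoundedDomain N}

theorem incl_injective (Ω : BoundedDomain N) : Function.Injective Ω.incl := fun _ _ h => ext_incl h

theorem IsOfClass.finiteDimensional_neumannEigenspace {k : ℕ} {α : ℝ≥0} (hΩ : Ω.IsOfClass k α)
    {σ : ℝ} (hσ0 : 0 ≤ σ) (hσ1 : σ < 1) (lam : ℝ) :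
    FiniteDimensional ℝ (Ω.neumannEigenspace σ lam) := by
  obtain ⟨c, hc, hco⟩ := hΩ.exists_le_energyL_add hσ0 hσ1
  exact finiteDimensional_eigenspace (fun _ _ => mem_neumannEigenspace_iff)
    (energyL_self_nonneg hσ0 hσ1) hc hco Ω.incl_injective hΩ.isCompactOperator_incl lam

theorem IsOfClass.exists_strictMono_range_eq_eigenvalues (hN : 1 ≤ N) {k : ℕ} {α : ℝ≥0}
    (hΩ : Ω.IsOfClass k α) {σ : ℝ} (hσ0 : 0 ≤ σ) (hσ1 : σ < 1) :
    ∃ ν : ℕ → ℝ, StrictMono ν ∧ Tendsto ν atTop atTop ∧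
      Set.range ν = {lam | Ω.IsNeumannEigenvalue σ lam} := by
  obtain ⟨c, hc, hco⟩ := hΩ.exists_le_energyL_add hσ0 hσ1
  refine exists_strictMono_range_eq ?_ fun M => ?_
  · exact infinite_setOf_eigenvalue (fun _ _ => mem_neumannEigenspace_iff) (energyL_symm σ)
      (energyL_self_nonneg hσ0 hσ1) hc hco Ω.incl_injective hΩ.isCompactOperator_incl
      (fun f => eq_zero_of_forall_inner_incl) (not_finiteDimensional_L2 hN Ω)
  · exact finite_setOf_eigenvalue_le (fun _ _ => mem_neumannEigenspace_iff) (energyL_symm σ)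
      hc hco Ω.incl_injective hΩ.isCompactOperator_incl M

end

end BoundedDomain

end

/-! ### Assembly of the statements. -/

theorem mainTheorem4 {N : ℕ} (hN : 1 ≤ N) (Ω : BoundedDomain N) (α : NNReal)
    (hα0 : 0 < α) (hα1 : α < 1) (hΩ : Ω.IsOfClass 4 α) (σ : ℝ) (hσ0 : 0 ≤ σ) (hσ1 : σ < 1) :
    -- the two maps inverted in the definition of `T σ` are linear homeomorphisms
    Ω.piSharp.IsInvertible ∧ (Ω.calP σ).IsInvertible ∧
    -- `scalarProd σ` is a scalar product whose norm is equivalent to the quotient norm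
    (∀ x y, Ω.scalarProd σ x y = Ω.scalarProd σ y x) ∧
    (∃ c C : ℝ, 0 < c ∧ ∀ x, c * ‖x‖ ^ 2 ≤ Ω.scalarProd σ x x ∧
      Ω.scalarProd σ x x ≤ C * ‖x‖ ^ 2) ∧
    -- `T σ` is nonnegative, compact and self-adjoint
    (∀ x, 0 ≤ Ω.scalarProd σ (Ω.T σ x) x) ∧
    IsCompactOperator (Ω.T σ) ∧
    (∀ x y, Ω.scalarProd σ (Ω.T σ x) y = Ω.scalarProd σ x (Ω.T σ y)) ∧
    -- its eigenvalues are the reciprocals of the positive Neumann eigenvalues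
    {μ : ℝ | Module.End.HasEigenvalue (Ω.T σ : (Ω.H2 ⧸ Ω.calN) →ₗ[ℝ] (Ω.H2 ⧸ Ω.calN)) μ} =
      {μ : ℝ | ∃ lam : ℝ, 0 < lam ∧ Ω.IsNeumannEigenvalue σ lam ∧ μ = lam⁻¹} ∧
    -- the Neumann eigenvalues are nonnegative, have finite multiplicity, and form a sequence
    -- increasing to infinity, whose first term is zero
    (∀ lam : ℝ, Ω.IsNeumannEigenvalue σ lam → 0 ≤ lam) ∧
    (∀ lam : ℝ, FiniteDimensional ℝ (Ω.neumannEigenspace σ lam)) ∧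
    (∃ ν : ℕ → ℝ, ν 0 = 0 ∧ StrictMono ν ∧ Filter.Tendsto ν Filter.atTop Filter.atTop ∧
      Set.range ν = {lam : ℝ | Ω.IsNeumannEigenvalue σ lam}) ∧
    -- zero has multiplicity `N + 1`, with eigenfunctions `1, x_1, …, x_N`
    Module.finrank ℝ (Ω.neumannEigenspace σ 0) = N + 1 ∧
    LinearIndependent ℝ Ω.affineBasis ∧
    Submodule.span ℝ (Set.range Ω.affineBasis) = Ω.neumannEigenspace σ 0 := by
  have hP := hΩ.isInvertible_calP hσ0 hσ1
  obtain ⟨ν, hmono, htend, hrange⟩ := hΩ.exists_strictMono_range_eq_eigenvalues hN hσ0 hσ1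
  have h0 : Module.finrank ℝ (Ω.neumannEigenspace σ 0) = N + 1 := by
    rw [hΩ.neumannEigenspace_zero hσ0 hσ1, BoundedDomain.calN,
      finrank_span_eq_card Ω.linearIndependent_affineBasis, Fintype.card_fin]
  refine ⟨BoundedDomain.isInvertible_piSharp, hP, BoundedDomain.scalarProd_symm σ,
    hΩ.scalarProd_equivalent hσ0 hσ1, fun x => ?_, hΩ.isCompactOperator_T σ, fun x y => ?_,
    hΩ.setOf_hasEigenvalue_T hσ0 hσ1, fun lam h => h.nonneg hσ0 hσ1,
    hΩ.finiteDimensional_neumannEigenspace hσ0 hσ1, ⟨ν, ?_, hmono, htend, hrange⟩, h0,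
    Ω.linearIndependent_affineBasis, (hΩ.neumannEigenspace_zero hσ0 hσ1).symm⟩
  · rw [BoundedDomain.scalarProd_T hP]
    exact real_inner_self_nonneg
  · rw [BoundedDomain.scalarProd_T hP, BoundedDomain.scalarProd_symm, BoundedDomain.scalarProd_T hP,
      real_inner_comm]
  -- `0` is some term of the increasing sequence, so `ν 0 ≤ 0`; as an eigenvalue, `ν 0` is also
  -- nonnegative.
  · obtain ⟨n, hn⟩ : (0 : ℝ) ∈ Set.range ν := by
      rw [hrange]
      exact Ω.isNeumannEigenvalue_zero σ
    have h1 : Ω.IsNeumannEigenvalue σ (ν 0) := by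
      have : ν 0 ∈ Set.range ν := Set.mem_range_self 0
      rwa [hrange] at this
    exact le_antisymm ((hmono.monotone n.zero_le).trans hn.le) (h1.nonneg hσ0 hσ1)
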